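/- For $c\in\mathbb{R}$ let $\mathbb{H}_c=L^2(\mathbb{R},e^{-2ct}\,dt)$ (complex-valued functions), let $\partial_c f=f'$ be the infinitesimal shift with domain $D(\partial_c)=\{f\in\mathbb{H}_c : f \text{ locally absolutely continuous on } \mathbb{R},\ f'\in\mathbb{H}_c\}$, and let $V_c=\frac{1}{i}(\partial_c-c)$, an unbounded self-adjoint operator on $\mathbb{H}_c$ with domain $D(\partial_c)$; the spectral operator is $\mathfrak{a}_c=\zeta(\partial_c)=\zeta(c+iV_c)$, where $\zeta$ is the Riemann zeta function. For $0\le T_0<T$, a $(T_0,T)$-admissible cut-off function is a Borel function $\phi:\mathbb{R}\to\mathbb{R}$ whose essential range with respect to Lebesgue measure (for continuous $\phi$, this is the closure of the range) equals $\{\tau\in\mathbb{R} : T_0\le|\tau|\le T\}$. For every $c\in(\frac12,1)$ and all $0\le T_0<T$ choose any such function $\phi_c^{(T_0,T)}$, and let $$\mathfrak{a}_c^{(T_0,T)}=\zeta\big(c+i\,\phi_c^{(T_0,T)}(V_c)\big)$$ be the corresponding truncated spectral operator, where $\phi_c^{(T_0,T)}(V_c)$ is the bounded self-adjoint operator defined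 by the measurable functional calculus of $V_c$, and $\zeta$ is applied to the bounded normal operator $c+i\,\phi_c^{(T_0,T)}(V_c)$ by the functional calculus. The operator $\mathfrak{a}_c$ is called almost invertible if there is $T_0\ge 0$ (which may depend on $c$) such that $\mathfrak{a}_c^{(T_0,T)}$ is invertible with bounded inverse on $\mathbb{H}_c$ for all $T>T_0$. Theorem. For every such choice of cut-off functions, the spectral operator $\mathfrak{a}_c$ is almost invertible for all $c\in(\frac12,1)$ if and only if the Riemann hypothesis is almost true, that is, for every $c>\frac12$ there are at most finitely many zeros of $\zeta$ on the vertical line $\operatorname{Re}(s)=c$. -/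

import Mathlib

open MeasureTheory Filter Topology

namespace SpectralOp

/-! ### Borel functional calculus of a self-adjoint operator -/

section FunctionalCalculus

variable {H : Type*} [NormedAddCommGroup H] [InnerProductSpace ℂ H] [CompleteSpace H]

variable (H) in
/-- A projection-valued measure (resolution of the identity) on the Borel sets of `ℝ`, acting on the
Hilbert space `H`. The values of `proj` on non-measurable sets are irrelevant. -/
structure ProjectionValuedMeasure where
  /-- The orthogonal projection attached to a Borel set. -/
  proj : Set ℝ → H →L[ℂ] H
  isStarProjection : ∀ s, MeasurableSet s → IsStarProjection (proj s)
  proj_univ : proj Set.univ = 1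
  proj_inter : ∀ s t, MeasurableSet s → MeasurableSet t → proj (s ∩ t) = proj s * proj t
  hasSum_iUnion : ∀ s : ℕ → Set ℝ, (∀ n, MeasurableSet (s n)) →
    Pairwise (Function.onFun Disjoint s) →
    ∀ x : H, HasSum (fun n => proj (s n) x) (proj (⋃ n, s n) x)

namespace ProjectionValuedMeasure

variable (E : ProjectionValuedMeasure H)

theorem inner_proj_self (x : H) {s : Set ℝ} (hs : MeasurableSet s) :
    inner ℂ x (E.proj s x) = ((‖E.proj s x‖ ^ 2 : ℝ) : ℂ) := by
  have h := E.isStarProjection s hs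
  have h1 : E.proj s (E.proj s x) = E.proj s x := by
    have := congrArg (fun A : H →L[ℂ] H => A x) h.isIdempotentElem.eq
    simpa using this
  have h2 : inner ℂ (E.proj s x) (E.proj s x) = inner ℂ x (E.proj s (E.proj s x)) := by
    have h3 := ContinuousLinearMap.adjoint_inner_left (E.proj s) (E.proj s x) x
    have h4 : ContinuousLinearMap.adjoint (E.proj s) = E.proj s := h.isSelfAdjoint
    rwa [h4] at h3
  rw [h1] at h2
  rw [← h2, inner_self_eq_norm_sq_to_K]
  simp

theorem proj_empty : E.proj ∅ = 0 := by
  ext x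
  have h := E.hasSum_iUnion (fun _ => ∅) (fun _ => MeasurableSet.empty)
    (fun _ _ _ => by simp [Function.onFun]) x
  have h0 : E.proj ∅ x = 0 := tendsto_nhds_unique tendsto_const_nhds h.summable.tendsto_atTop_zero
  simpa using h0

/-- The finite positive Borel measure `s ↦ ⟪x, E(s) x⟫ = ‖E(s) x‖²`. -/
noncomputable def measure (x : H) : Measure ℝ :=
  Measure.ofMeasurable (fun s _ => ENNReal.ofReal (‖E.proj s x‖ ^ 2))
    (by simp [E.proj_empty])
    (by
      intro s hs hd
      have h := (E.hasSum_iUnion s hs hd x).mapL (innerSL ℂ x)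
      have h' : HasSum (fun n => ‖E.proj (s n) x‖ ^ 2) (‖E.proj (⋃ n, s n) x‖ ^ 2) := by
        rw [← Complex.hasSum_ofReal]
        simp only [innerSL_apply_apply, E.inner_proj_self x (MeasurableSet.iUnion hs),
          fun n => E.inner_proj_self x (hs n)] at h
        exact h
      rw [← h'.tsum_eq, ENNReal.ofReal_tsum_of_nonneg (fun n => by positivity) h'.summable])

/-- `V = ∫ t dE(t)`: the domain of `V` is the set of `x` with `∫ t² d⟪x, E(t) x⟫ < ∞`, and
`⟪x, V x⟫ = ∫ t d⟪x, E(t) x⟫` there. (By polarization this determines `V`.) -/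
def Resolves (V : H →ₗ.[ℂ] H) : Prop :=
  (∀ x : H, x ∈ V.domain ↔ Integrable (fun t : ℝ => t ^ 2) (E.measure x)) ∧
  ∀ x : V.domain, inner ℂ (x : H) (V x) = ∫ t : ℝ, (t : ℂ) ∂(E.measure (x : H))

end ProjectionValuedMeasure

/-- `B = g(V) = ∫ g dE`, a bounded operator, where `E` is the spectral measure of `V`. -/
def IsBorelCalculus (V : H →ₗ.[ℂ] H) (g : ℝ → ℂ) (B : H →L[ℂ] H) : Prop :=
  ∃ E : ProjectionValuedMeasure H, E.Resolves V ∧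
    ∀ x : H, Integrable g (E.measure x) ∧ inner ℂ x (B x) = ∫ t, g t ∂(E.measure x)

open Classical in
/-- The bounded operator `g(V)` given by the measurable functional calculus of the self-adjoint
operator `V`, for a Borel function `g` that is essentially bounded with respect to the spectral
measure of `V`. (Junk value `0` if there is no such operator.) -/
noncomputable def borelCalculus (V : H →ₗ.[ℂ] H) (g : ℝ → ℂ) : H →L[ℂ] H :=
  if h : ∃ B, IsBorelCalculus V g B then h.choose else 0

end FunctionalCalculus

/-! ### The weighted space, the infinitesimal shift and the momentum operator -/

/-- The measure `e^{-2ct} dt` on `ℝ`. -/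
noncomputable def weight (c : ℝ) : Measure ℝ :=
  volume.withDensity (fun t => ENNReal.ofReal (Real.exp (-2 * c * t)))

/-- The Hilbert space `ℍ_c = L²(ℝ, e^{-2ct} dt)` of complex-valued functions. -/
abbrev HSpace (c : ℝ) : Type := Lp ℂ 2 (weight c)

theorem volume_ac_weight (c : ℝ) : volume ≪ weight c :=
  withDensity_absolutelyContinuous' (by fun_prop)
    (ae_of_all _ fun t => by simp [Real.exp_pos])

/-- The graph of the infinitesimal shift: the pairs `(f, f')` with `f, f' ∈ ℍ_c` and `f` (having a
representative `u` that is) locally absolutely continuous on `ℝ`. -/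
noncomputable def shiftGraph (c : ℝ) : Submodule ℂ (HSpace c × HSpace c) where
  carrier := {p | ∃ u : ℝ → ℂ, (∀ a b : ℝ, AbsolutelyContinuousOnInterval u a b) ∧
    (p.1 : ℝ → ℂ) =ᵐ[weight c] u ∧ ∀ᵐ t ∂(weight c), HasDerivAt u ((p.2 : ℝ → ℂ) t) t}
  zero_mem' := by
    refine ⟨0, fun a b => ?_, Lp.coeFn_zero _ _ _, ?_⟩
    · exact (contDiff_const (c := (0 : ℂ)) (n := 1)).contDiffOn.absolutelyContinuousOnInterval
    · filter_upwards [Lp.coeFn_zero ℂ 2 (weight c)] with t ht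
      have : (((0 : HSpace c × HSpace c).2 : HSpace c) : ℝ → ℂ) t = 0 := ht
      rw [this]
      exact hasDerivAt_const t 0
  add_mem' := by
    rintro p q ⟨u, hu, hpu, hu'⟩ ⟨v, hv, hqv, hv'⟩
    refine ⟨u + v, fun a b => (hu a b).add (hv a b), ?_, ?_⟩
    · exact (Lp.coeFn_add p.1 q.1).trans (hpu.add hqv)
    · filter_upwards [hu', hv', Lp.coeFn_add p.2 q.2] with t h1 h2 h3
      have : (((p + q).2 : HSpace c) : ℝ → ℂ) t = (p.2 : ℝ → ℂ) t + (q.2 : ℝ → ℂ) t := h3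
      rw [this]
      exact h1.add h2
  smul_mem' := by
    rintro k p ⟨u, hu, hpu, hu'⟩
    refine ⟨k • u, fun a b => (hu a b).const_smul k, ?_, ?_⟩
    · exact (Lp.coeFn_smul k p.1).trans (hpu.const_smul k)
    · filter_upwards [hu', Lp.coeFn_smul k p.2] with t h1 h3
      have : (((k • p).2 : HSpace c) : ℝ → ℂ) t = k • (p.2 : ℝ → ℂ) t := h3
      rw [this]
      exact h1.const_smul k

/-- The relation `shiftGraph c` is indeed the graph of an operator. -/
theorem shiftGraph_functional (c : ℝ) (p : HSpace c × HSpace c) (hp : p ∈ shiftGraph c)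
    (h0 : p.1 = 0) : p.2 = 0 := by
  obtain ⟨u, hu, hpu, hu'⟩ := hp
  have hcont : Continuous u := by
    rw [continuous_iff_continuousAt]
    intro t
    refine (hu (t - 1) (t + 1)).continuousOn.continuousAt ?_
    rw [Set.uIcc_of_le (by linarith)]
    exact Icc_mem_nhds (by linarith) (by linarith)
  have hz : u =ᵐ[volume] fun _ => (0 : ℂ) := by
    refine (volume_ac_weight c).ae_le ?_
    have h1 : ((0 : HSpace c) : ℝ → ℂ) =ᵐ[weight c] 0 := Lp.coeFn_zero _ _ _
    rw [h0] at hpu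
    filter_upwards [hpu, h1] with t h2 h3
    rw [← h2, h3]
    rfl
  have hu0 : u = fun _ => (0 : ℂ) := hcont.ae_eq_iff_eq volume continuous_const |>.1 hz
  apply Lp.ext
  filter_upwards [hu', Lp.coeFn_zero ℂ 2 (weight c)] with t h1 h2
  rw [h2, hu0] at *
  exact h1.unique (hasDerivAt_const t 0)

/-- The infinitesimal shift `∂_c f = f'` on `ℍ_c`, with domain
`{f ∈ ℍ_c ∩ AC(ℝ) : f' ∈ ℍ_c}`. -/
noncomputable def infinitesimalShift (c : ℝ) : HSpace c →ₗ.[ℂ] HSpace c :=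
  (shiftGraph c).toLinearPMap

/-- The `c`-momentum operator `V_c = (∂_c - c) / i`, with the domain of `∂_c`. -/
noncomputable def momentum (c : ℝ) : HSpace c →ₗ.[ℂ] HSpace c :=
  Complex.I⁻¹ • ((-((c : ℂ) • (LinearMap.id : HSpace c →ₗ[ℂ] HSpace c))) +ᵥ infinitesimalShift c)

/-! ### Truncations and almost invertibility -/

/-- The essential range, with respect to Lebesgue measure, of a function `φ : ℝ → ℝ`. -/
def essRange (φ : ℝ → ℝ) : Set ℝ :=
  {y | ∀ U ∈ 𝓝 y, 0 < volume (φ ⁻¹' U)}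

/-- For a continuous function, the essential range is the closure of the range. -/
theorem essRange_eq_closure_range {φ : ℝ → ℝ} (hφ : Continuous φ) :
    essRange φ = closure (Set.range φ) := by
  ext y
  rw [mem_closure_iff_nhds]
  constructor
  · intro h U hU
    obtain ⟨x, hx⟩ := nonempty_of_measure_ne_zero (h U hU).ne'
    exact ⟨φ x, hx, x, rfl⟩
  · intro h U hU
    obtain ⟨_, hz, x, rfl⟩ := h (interior U) (interior_mem_nhds.2 hU)
    exact ((isOpen_interior.preimage hφ).measure_pos volume ⟨x, hz⟩).trans_le
      (measure_mono (Set.preimage_mono interior_subset))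

/-- A `(T₀, T)`-admissible cut-off function: a Borel function whose essential range (for a
continuous function: the closure of the range) is `{τ : T₀ ≤ |τ| ≤ T}`. Continuity itself cannot be
asked for, since `{τ : T₀ ≤ |τ| ≤ T}` is disconnected for `T₀ > 0`. -/
def IsAdmissibleCutoff (T₀ T : ℝ) (φ : ℝ → ℝ) : Prop :=
  Measurable φ ∧ essRange φ = {τ : ℝ | T₀ ≤ |τ| ∧ |τ| ≤ T}

/-- Admissible cut-off functions exist. -/
theorem exists_isAdmissibleCutoff {T₀ T : ℝ} (h0 : 0 ≤ T₀) (hT : T₀ < T) :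
    ∃ φ : ℝ → ℝ, IsAdmissibleCutoff T₀ T φ := by
  classical
  set S : Set ℝ := {τ : ℝ | T₀ ≤ |τ| ∧ |τ| ≤ T} with hS
  have hSc : IsClosed S :=
    (isClosed_le continuous_const continuous_abs).inter
      (isClosed_le continuous_abs continuous_const)
  have hTS : T ∈ S := by
    have : |T| = T := abs_of_pos (by linarith)
    exact ⟨by rw [this]; exact hT.le, this.le⟩
  refine ⟨fun t => if t ∈ S then t else T,
    Measurable.ite hSc.measurableSet measurable_id measurable_const, ?_⟩
  ext y
  constructor
  · intro h
    by_contra hy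
    have := h Sᶜ (hSc.isOpen_compl.mem_nhds hy)
    obtain ⟨x, hx⟩ := nonempty_of_measure_ne_zero this.ne'
    by_cases hxS : x ∈ S <;> simp [hxS, hTS] at hx
  · rintro hy U hU
    obtain ⟨e, he, hball⟩ := Metric.mem_nhds_iff.1 hU
    have key : ∃ a b : ℝ, a < b ∧ Set.Ioo a b ⊆ S ∩ Metric.ball y e := by
      rcases le_or_gt 0 y with hy0 | hy0
      · obtain ⟨h1, h2⟩ := hy
        rw [abs_of_nonneg hy0] at h1 h2
        refine ⟨max T₀ (y - e), min T (y + e), ?_, ?_⟩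
        · simp only [max_lt_iff, lt_min_iff]
          exact ⟨⟨hT, by linarith⟩, by linarith, by linarith⟩
        · rintro t ⟨ha, hb⟩
          rw [max_lt_iff] at ha
          rw [lt_min_iff] at hb
          have : |t| = t := abs_of_nonneg (by linarith)
          refine ⟨⟨by rw [this]; linarith, by rw [this]; linarith⟩, ?_⟩
          rw [Metric.mem_ball, Real.dist_eq, abs_lt]
          constructor <;> linarith
      · obtain ⟨h1, h2⟩ := hy
        rw [abs_of_neg hy0] at h1 h2
        refine ⟨max (-T) (y - e), min (-T₀) (y + e), ?_, ?_⟩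
        · simp only [max_lt_iff, lt_min_iff]
          exact ⟨⟨by linarith, by linarith⟩, by linarith, by linarith⟩
        · rintro t ⟨ha, hb⟩
          rw [max_lt_iff] at ha
          rw [lt_min_iff] at hb
          have : |t| = -t := abs_of_nonpos (by linarith)
          refine ⟨⟨by rw [this]; linarith, by rw [this]; linarith⟩, ?_⟩
          rw [Metric.mem_ball, Real.dist_eq, abs_lt]
          constructor <;> linarith
    obtain ⟨a, b, hab, hsub⟩ := key
    refine (isOpen_Ioo.measure_pos volume (Set.nonempty_Ioo.2 hab)).trans_le (measure_mono ?_)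
    intro t ht
    have := hsub ht
    simp only [Set.mem_preimage, if_pos this.1]
    exact hball this.2

/-- The truncated infinitesimal shift `c + i φ(V_c)` for the cut-off function `φ`. -/
noncomputable def truncatedShift (c : ℝ) (φ : ℝ → ℝ) : HSpace c →L[ℂ] HSpace c :=
  (c : ℂ) • 1 + Complex.I • borelCalculus (momentum c) (fun t => (φ t : ℂ))

/-- The truncated spectral operator `ζ(c + i φ(V_c))`, through the continuous functional calculus of
the bounded normal operator `c + i φ(V_c)` (`ζ` is continuous on its spectrum when `c ≠ 1`). -/
noncomputable def truncatedSpectralOperator (c : ℝ) (φ : ℝ → ℝ) : HSpace c →L[ℂ] HSpace c :=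
  cfc riemannZeta (truncatedShift c φ)

/-- Almost invertibility of the spectral operator `𝔞_c`, where `φ T₀ T` is the cut-off function used
for the `(T₀, T)`-truncation: for some `T₀ ≥ 0`, the truncations of `𝔞_c` are invertible (with
bounded inverse) for all `T > T₀`. -/
def AlmostInvertible (c : ℝ) (φ : ℝ → ℝ → ℝ → ℝ) : Prop :=
  ∃ T₀ : ℝ, 0 ≤ T₀ ∧ ∀ T : ℝ, T₀ < T → IsUnit (truncatedSpectralOperator c (φ T₀ T))

/-- The almost Riemann hypothesis: on every vertical line `Re s = c` with `c > 1/2` there are at most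
finitely many zeros of the Riemann zeta function. -/
def AlmostRH : Prop :=
  ∀ c : ℝ, 1 / 2 < c → {s : ℂ | s.re = c ∧ riemannZeta s = 0}.Finite

end SpectralOp

/-!
Fourier transform, after the unitary `f ↦ e^{-ct} f` from `ℍ_c` to `L²(ℝ)`, turns `V_c` into
multiplication by `2πξ`. The spectral measure of an operator is unique, so a Borel function `g(V_c)`
is unitarily equivalent to multiplication by `g(2πξ)`, and the spectrum of `c + i φ(V_c)` is
`c + i essRange φ = {c + iτ : T₀ ≤ |τ| ≤ T}`. By the spectral mapping theorem the truncated operator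
is invertible exactly when `ζ` has no zero there. Finitely many zeros on the line `Re s = c` are
avoided by a large `T₀`; conversely, if all zeros on the line lie below height `T₀`, they are finite
in number by compactness. On `Re s ≥ 1` there are no zeros at all.
-/

namespace SpectralOp

open InnerProductSpace

/-! ### Uniqueness of the spectral measure -/

section SpectralMeasure

variable {H : Type*} [NormedAddCommGroup H] [InnerProductSpace ℂ H] [CompleteSpace H]

namespace ProjectionValuedMeasure

variable (E F : ProjectionValuedMeasure H)

theorem measure_apply (x : H) {s : Set ℝ} (hs : MeasurableSet s) :
    E.measure x s = ENNReal.ofReal (‖E.proj s x‖ ^ 2) :=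
  Measure.ofMeasurable_apply s hs

theorem measure_real_apply (x : H) {s : Set ℝ} (hs : MeasurableSet s) :
    (E.measure x).real s = ‖E.proj s x‖ ^ 2 := by
  rw [measureReal_def, E.measure_apply x hs, ENNReal.toReal_ofReal (by positivity)]

instance isFiniteMeasure_measure (x : H) : IsFiniteMeasure (E.measure x) :=
  ⟨by rw [E.measure_apply x .univ]; exact ENNReal.ofReal_lt_top⟩

theorem measure_eq_zero_iff (x : H) {s : Set ℝ} (hs : MeasurableSet s) :
    E.measure x s = 0 ↔ E.proj s x = 0 := by
  rw [← measureReal_eq_zero_iff, E.measure_real_apply x hs, sq_eq_zero_iff, norm_eq_zero]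

theorem proj_proj {s t : Set ℝ} (hs : MeasurableSet s) (ht : MeasurableSet t) (x : H) :
    E.proj s (E.proj t x) = E.proj (s ∩ t) x := by
  rw [E.proj_inter s t hs ht]
  rfl

theorem inner_proj {s : Set ℝ} (hs : MeasurableSet s) (x y : H) :
    inner ℂ (E.proj s x) y = inner ℂ x (E.proj s y) :=
  (E.isStarProjection s hs).isSelfAdjoint.isSymmetric x y

theorem measure_proj (x : H) {s : Set ℝ} (hs : MeasurableSet s) :
    E.measure (E.proj s x) = (E.measure x).restrict s := by
  ext t ht
  rw [Measure.restrict_apply ht, E.measure_apply _ ht, E.measure_apply _ (ht.inter hs),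
    E.proj_proj ht hs]

theorem proj_add_proj_compl {s : Set ℝ} (hs : MeasurableSet s) (x : H) :
    E.proj s x + E.proj sᶜ x = x := by
  set d := x - (E.proj s x + E.proj sᶜ x) with hd
  have hds : E.proj s d = 0 := by
    simp only [hd, map_sub, map_add, E.proj_proj hs hs, E.proj_proj hs hs.compl, Set.inter_self,
      Set.inter_compl_self, E.proj_empty, zero_apply, add_zero, sub_self]
  have hdsc : E.proj sᶜ d = 0 := by
    simp only [hd, map_sub, map_add, E.proj_proj hs.compl hs, E.proj_proj hs.compl hs.compl,
      Set.inter_self, Set.compl_inter_self, E.proj_empty, zero_apply, zero_add,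
      sub_self]
  have hd0 : E.measure d Set.univ = 0 := by
    rw [← Set.union_compl_self s]
    exact measure_union_null ((E.measure_eq_zero_iff d hs).2 hds)
      ((E.measure_eq_zero_iff d hs.compl).2 hdsc)
  rw [E.measure_eq_zero_iff d .univ, E.proj_univ] at hd0
  exact (sub_eq_zero.1 hd0).symm

theorem proj_eq_zero_of_locally {s : Set ℝ} (hs : MeasurableSet s) (x : H)
    (h : ∀ t ∈ s, ∃ u ∈ 𝓝[s] t, MeasurableSet u ∧ E.proj u x = 0) : E.proj s x = 0 := by
  rw [← E.measure_eq_zero_iff x hs]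
  refine measure_null_of_locally_null s fun t ht => ?_
  obtain ⟨u, hut, hu, hux⟩ := h t ht
  exact ⟨u, hut, (E.measure_eq_zero_iff x hu).2 hux⟩

variable {E F} in
theorem proj_proj_eq_zero_comm {s t : Set ℝ} (hs : MeasurableSet s) (ht : MeasurableSet t)
    (h : ∀ x, F.proj t (E.proj s x) = 0) (x : H) : E.proj s (F.proj t x) = 0 := by
  rw [← inner_self_eq_zero (𝕜 := ℂ), E.inner_proj hs, F.inner_proj ht, h, inner_zero_right]

theorem inner_proj_proj_compl {s t : Set ℝ} (hs : MeasurableSet s) (ht : MeasurableSet t)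
    (x y : H) : inner ℂ (E.proj t (E.proj s x)) (E.proj t (E.proj sᶜ y)) = 0 := by
  have h : s ∩ (t ∩ (t ∩ sᶜ)) = ∅ := by grind
  rw [E.inner_proj ht, E.inner_proj hs, E.proj_proj ht hs.compl,
    E.proj_proj ht (ht.inter hs.compl), E.proj_proj hs (ht.inter (ht.inter hs.compl)), h,
    E.proj_empty, zero_apply, inner_zero_right]

theorem measure_proj_add_proj_compl {s : Set ℝ} (hs : MeasurableSet s) (x y : H) :
    E.measure (E.proj s x + E.proj sᶜ y) = E.measure (E.proj s x) + E.measure (E.proj sᶜ y) := by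
  ext t ht
  rw [Measure.add_apply, E.measure_apply _ ht, E.measure_apply _ ht, E.measure_apply _ ht, map_add,
    ← ENNReal.ofReal_add (by positivity) (by positivity), sq, sq, sq,
    norm_add_sq_eq_norm_sq_add_norm_sq_of_inner_eq_zero _ _ (E.inner_proj_proj_compl hs ht x y)]

theorem setIntegral_Icc_mem (a b : ℝ) (x : H) :
    ∫ t in Set.Icc a b, t ∂(E.measure x) ∈
      Set.Icc (a * ‖E.proj (Set.Icc a b) x‖ ^ 2) (b * ‖E.proj (Set.Icc a b) x‖ ^ 2) := by
  have hint : IntegrableOn (fun t : ℝ => t) (Set.Icc a b) (E.measure x) :=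
    continuousOn_id.integrableOn_compact isCompact_Icc
  have hconst (k : ℝ) :
      ∫ _ in Set.Icc a b, k ∂(E.measure x) = k * ‖E.proj (Set.Icc a b) x‖ ^ 2 := by
    rw [setIntegral_const, E.measure_real_apply x measurableSet_Icc, smul_eq_mul, mul_comm]
  rw [← hconst, ← hconst]
  exact ⟨setIntegral_mono_on (integrableOn_const (by simp)) hint measurableSet_Icc fun t ht => ht.1,
    setIntegral_mono_on hint (integrableOn_const (by simp)) measurableSet_Icc fun t ht => ht.2⟩

end ProjectionValuedMeasure

variable {E F : ProjectionValuedMeasure H} {V : H →ₗ.[ℂ] H}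

theorem norm_apply_le_of_inner_eq {T : H →ₗ[ℂ] H} {q : H → ℝ} {r : ℝ} (hr : 0 ≤ r)
    (hT : ∀ x, inner ℂ x (T x) = q x) (hq : ∀ x, |q x| ≤ r * ‖x‖ ^ 2) (x : H) :
    ‖T x‖ ≤ r * ‖x‖ := by
  have hT' (y : H) : inner ℂ (T y) y = q y := by
    rw [← inner_conj_symm, hT, Complex.conj_ofReal]
  have hsymm : T.IsSymmetric := by
    rw [LinearMap.isSymmetric_iff_inner_map_self_real]
    exact fun y => by rw [hT', Complex.conj_ofReal]
  let S : H →L[ℂ] H := hsymm.toSelfAdjoint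
  refine S.le_of_opNorm_le ?_ x
  rw [S.norm_eq_iSup_rayleighQuotient hsymm]
  refine ciSup_le fun y => ?_
  rw [abs_div, abs_sq]
  refine div_le_of_le_mul₀ (sq_nonneg _) hr ?_
  have hS : inner ℂ (S y) y = q y := hT' y
  rw [S.reApplyInnerSelf_apply, hS]
  exact hq y

namespace ProjectionValuedMeasure.Resolves

theorem integrable_id (hE : E.Resolves V) {x : H} (hx : x ∈ V.domain) :
    Integrable (fun t : ℝ => t) (E.measure x) := by
  have hsq : MemLp (fun t : ℝ => t) 2 (E.measure x) :=
    (memLp_two_iff_integrable_sq aestronglyMeasurable_id).2 ((hE.1 x).1 hx)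
  exact hsq.integrable one_le_two

theorem proj_mem_domain (hE : E.Resolves V) {s : Set ℝ} (hs : MeasurableSet s) {x : H}
    (hx : x ∈ V.domain) : E.proj s x ∈ V.domain := by
  rw [hE.1, E.measure_proj x hs]
  exact ((hE.1 x).1 hx).restrict

theorem proj_Icc_mem_domain (hE : E.Resolves V) (a b : ℝ) (x : H) :
    E.proj (Set.Icc a b) x ∈ V.domain := by
  rw [hE.1, E.measure_proj x measurableSet_Icc]
  exact (continuous_pow 2).continuousOn.integrableOn_compact isCompact_Icc

theorem eq_zero_of_forall_inner_eq_zero (hE : E.Resolves V) {y : H}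
    (hy : ∀ x ∈ V.domain, inner ℂ y x = 0) : y = 0 := by
  have h := E.proj_eq_zero_of_locally .univ y fun t _ =>
    ⟨Set.Icc (t - 1) (t + 1), mem_nhdsWithin_of_mem_nhds (Icc_mem_nhds (by simp) (by simp)),
      measurableSet_Icc, ?_⟩
  · rwa [E.proj_univ] at h
  · have h0 := E.inner_proj_self y (measurableSet_Icc (a := t - 1) (b := t + 1))
    rw [hy _ (hE.proj_Icc_mem_domain _ _ y)] at h0
    simpa using h0.symm

theorem inner_proj_compl_map_proj (hE : E.Resolves V) {s : Set ℝ} (hs : MeasurableSet s)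
    {x y : H} (hx : x ∈ V.domain) (hy : y ∈ V.domain) :
    inner ℂ (E.proj sᶜ y) (V ⟨E.proj s x, hE.proj_mem_domain hs hx⟩) = 0 := by
  set x₁ : V.domain := ⟨E.proj s x, hE.proj_mem_domain hs hx⟩
  have cross (z : H) (hz : z ∈ V.domain) :
      inner ℂ (x₁ : H) (V ⟨E.proj sᶜ z, hE.proj_mem_domain hs.compl hz⟩) +
        inner ℂ (E.proj sᶜ z) (V x₁) = 0 := by
    set z₁ : V.domain := ⟨E.proj sᶜ z, hE.proj_mem_domain hs.compl hz⟩
    have h : inner ℂ ((x₁ : H) + z₁) (V (x₁ + z₁)) =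
        inner ℂ (x₁ : H) (V x₁) + inner ℂ (z₁ : H) (V z₁) := by
      rw [← Submodule.coe_add, hE.2, hE.2, hE.2, Submodule.coe_add,
        E.measure_proj_add_proj_compl hs x z, integral_add_measure]
      exacts [(hE.integrable_id x₁.2).ofReal, (hE.integrable_id z₁.2).ofReal]
    rw [V.map_add, inner_add_left, inner_add_right, inner_add_right] at h
    linear_combination h
  have h1 := cross y hy
  have h2 := cross (Complex.I • y) (V.domain.smul_mem _ hy)
  have hI : (⟨E.proj sᶜ (Complex.I • y), hE.proj_mem_domain hs.compl (V.domain.smul_mem _ hy)⟩ :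
      V.domain) = Complex.I • ⟨E.proj sᶜ y, hE.proj_mem_domain hs.compl hy⟩ :=
    Subtype.ext (map_smul _ _ _)
  rw [hI, V.map_smul, map_smul, inner_smul_left, inner_smul_right, Complex.conj_I] at h2
  have h3 : inner ℂ (x₁ : H) (V ⟨E.proj sᶜ y, hE.proj_mem_domain hs.compl hy⟩) =
      inner ℂ (E.proj sᶜ y) (V x₁) :=
    mul_left_cancel₀ Complex.I_ne_zero (by linear_combination h2)
  linear_combination (h1 - h3) / 2

theorem proj_compl_map_proj (hE : E.Resolves V) {s : Set ℝ} (hs : MeasurableSet s)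
    {x : H} (hx : x ∈ V.domain) :
    E.proj sᶜ (V ⟨E.proj s x, hE.proj_mem_domain hs hx⟩) = 0 := by
  refine hE.eq_zero_of_forall_inner_eq_zero fun y hy => ?_
  rw [E.inner_proj hs.compl, ← inner_conj_symm, hE.inner_proj_compl_map_proj hs hx hy, map_zero]

theorem map_proj (hE : E.Resolves V) {s : Set ℝ} (hs : MeasurableSet s) {x : H}
    (hx : x ∈ V.domain) :
    V ⟨E.proj s x, hE.proj_mem_domain hs hx⟩ = E.proj s (V ⟨x, hx⟩) := by
  set x₁ : V.domain := ⟨E.proj s x, hE.proj_mem_domain hs hx⟩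
  set x₂ : V.domain := ⟨E.proj sᶜ x, hE.proj_mem_domain hs.compl hx⟩
  have hsum : (⟨x, hx⟩ : V.domain) = x₁ + x₂ := Subtype.ext (E.proj_add_proj_compl hs x).symm
  have h₁ : E.proj sᶜ (V x₁) = 0 := hE.proj_compl_map_proj hs hx
  have h₂ : E.proj s (V x₂) = 0 := by
    have := hE.proj_compl_map_proj hs.compl hx
    rwa [compl_compl] at this
  rw [hsum, V.map_add, map_add, h₂, add_zero]
  simpa [h₁] using (E.proj_add_proj_compl hs (V x₁)).symm

theorem inner_proj_Icc (hE : E.Resolves V) (a b : ℝ) (x : H) :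
    inner ℂ (E.proj (Set.Icc a b) x) (V ⟨_, hE.proj_Icc_mem_domain a b x⟩) =
      ((∫ t in Set.Icc a b, t ∂(E.measure x) : ℝ) : ℂ) := by
  refine (hE.2 ⟨_, hE.proj_Icc_mem_domain a b x⟩).trans ?_
  rw [E.measure_proj x measurableSet_Icc]
  exact integral_ofReal

theorem proj_map_of_proj_eq (hE : E.Resolves V) {s : Set ℝ} (hs : MeasurableSet s) (x : V.domain)
    (hx : E.proj s x = x) : E.proj s (V x) = V x := by
  rw [← hE.map_proj hs x.2]
  exact congrArg V (Subtype.ext hx)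

theorem inner_map_proj_Icc (hE : E.Resolves V) (a b : ℝ) (x : H) :
    inner ℂ x (V ⟨_, hE.proj_Icc_mem_domain a b x⟩) =
      ((∫ t in Set.Icc a b, t ∂(E.measure x) : ℝ) : ℂ) := by
  have hPx : E.proj (Set.Icc a b) (E.proj (Set.Icc a b) x) = E.proj (Set.Icc a b) x := by
    rw [E.proj_proj measurableSet_Icc measurableSet_Icc, Set.inter_self]
  rw [← hE.proj_map_of_proj_eq measurableSet_Icc ⟨_, hE.proj_Icc_mem_domain a b x⟩ hPx,
    ← E.inner_proj measurableSet_Icc, hE.inner_proj_Icc]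

theorem norm_map_proj_Icc_sub_le (hE : E.Resolves V) (c : ℝ) {r : ℝ} (hr : 0 ≤ r) (x : H) :
    ‖V ⟨_, hE.proj_Icc_mem_domain (c - r) (c + r) x⟩ -
      (c : ℂ) • E.proj (Set.Icc (c - r) (c + r)) x‖ ≤ r * ‖x‖ := by
  set s := Set.Icc (c - r) (c + r)
  let T : H →ₗ[ℂ] H := V.toFun ∘ₗ (E.proj s).toLinearMap.codRestrict V.domain
    (hE.proj_Icc_mem_domain _ _) - (c : ℂ) • (E.proj s).toLinearMap
  let q (y : H) : ℝ := ∫ t in s, t ∂(E.measure y) - c * ‖E.proj s y‖ ^ 2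
  have hq (y : H) : inner ℂ y (T y) = (q y : ℂ) := by
    change inner ℂ y (V ⟨_, hE.proj_Icc_mem_domain _ _ y⟩ - (c : ℂ) • E.proj s y) = _
    rw [inner_sub_right, inner_smul_right, E.inner_proj_self y measurableSet_Icc,
      hE.inner_map_proj_Icc]
    push_cast [q]
    rfl
  refine norm_apply_le_of_inner_eq hr hq (fun y => ?_) x
  have hPy : ‖E.proj s y‖ ≤ ‖y‖ := by
    simpa using (E.proj s).le_of_opNorm_le (E.isStarProjection s measurableSet_Icc).norm_le y
  obtain ⟨hl, hu⟩ := E.setIntegral_Icc_mem (c - r) (c + r) y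
  calc |q y| ≤ r * ‖E.proj s y‖ ^ 2 := by rw [abs_le]; constructor <;> linarith
    _ ≤ r * ‖y‖ ^ 2 := by gcongr

theorem mul_norm_proj_Icc_le (hE : E.Resolves V) (c a b : ℝ) (x : H) :
    (a - c) * ‖E.proj (Set.Icc a b) x‖ ≤
      ‖V ⟨_, hE.proj_Icc_mem_domain a b x⟩ - (c : ℂ) • E.proj (Set.Icc a b) x‖ := by
  set y := E.proj (Set.Icc a b) x
  set z := V ⟨y, hE.proj_Icc_mem_domain a b x⟩
  rcases (norm_nonneg y).eq_or_lt' with hy | hy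
  · rw [hy, mul_zero]
    exact norm_nonneg _
  refine le_of_mul_le_mul_right ?_ hy
  have hre : RCLike.re (inner ℂ y z) = ∫ t in Set.Icc a b, t ∂(E.measure x) := by
    exact congrArg RCLike.re (hE.inner_proj_Icc a b x)
  calc (a - c) * ‖y‖ * ‖y‖ = a * ‖y‖ ^ 2 - c * ‖y‖ ^ 2 := by ring
    _ ≤ RCLike.re (inner ℂ y z) - c * ‖y‖ ^ 2 := by
      rw [hre]
      exact sub_le_sub_right (E.setIntegral_Icc_mem a b x).1 _
    _ = RCLike.re (inner ℂ y (z - (c : ℂ) • y)) := by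
      rw [inner_sub_right, inner_smul_right, map_sub, ← inner_self_eq_norm_sq (𝕜 := ℂ) y]
      exact congrArg (_ - ·) (Complex.re_ofReal_mul c _).symm
    _ ≤ ‖y‖ * ‖z - (c : ℂ) • y‖ := re_inner_le_norm _ _
    _ = ‖z - (c : ℂ) • y‖ * ‖y‖ := mul_comm _ _

/-- Rosenblum's intertwining argument: with `P = E([c - r, c + r])` and `Q = F([a, b])`, the
operator `V - c` is at most `r` on the range of `P` and at least `a - c > r` on that of `Q`, whence
`(a - c) ‖Q P‖ ≤ r ‖Q P‖`. -/
theorem proj_Icc_proj_Icc_eq_zero (hE : E.Resolves V) (hF : F.Resolves V) {c r a : ℝ} (hr : 0 ≤ r)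
    (h : c + r < a) (b : ℝ) (x : H) :
    F.proj (Set.Icc a b) (E.proj (Set.Icc (c - r) (c + r)) x) = 0 := by
  set P := E.proj (Set.Icc (c - r) (c + r))
  set Q := F.proj (Set.Icc a b)
  have hPP (x : H) : P (P x) = P x := by
    rw [E.proj_proj measurableSet_Icc measurableSet_Icc, Set.inter_self]
  have hac : 0 < a - c := by linarith
  have key (x : H) : ‖(Q * P) x‖ ≤ r / (a - c) * ‖Q * P‖ * ‖x‖ := by
    have hPx := hE.proj_Icc_mem_domain (c - r) (c + r) x
    set y := V ⟨P x, hPx⟩ - (c : ℂ) • P x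
    have hPy : P y = y := by
      rw [map_sub, map_smul, hPP, hE.proj_map_of_proj_eq measurableSet_Icc ⟨P x, hPx⟩ (hPP x)]
    have hQy : V ⟨_, hF.proj_Icc_mem_domain a b (P x)⟩ - (c : ℂ) • Q (P x) = Q y := by
      rw [hF.map_proj measurableSet_Icc hPx, map_sub, map_smul]
    rw [div_mul_eq_mul_div, div_mul_eq_mul_div, le_div_iff₀' hac]
    calc (a - c) * ‖Q (P x)‖ ≤ ‖Q y‖ := hQy ▸ hF.mul_norm_proj_Icc_le c a b (P x)
      _ = ‖(Q * P) y‖ := by rw [mul_apply_eq_comp, hPy]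
      _ ≤ ‖Q * P‖ * (r * ‖x‖) := (Q * P).le_opNorm_of_le (hE.norm_map_proj_Icc_sub_le c hr x)
      _ = r * ‖Q * P‖ * ‖x‖ := by ring
  have hQP := (Q * P).opNorm_le_bound (by positivity) key
  have hlt : r / (a - c) < 1 := (div_lt_one hac).2 (by linarith)
  have hzero : ‖Q * P‖ = 0 := by nlinarith [norm_nonneg (Q * P)]
  exact congrArg (fun A : H →L[ℂ] H => A x) (norm_eq_zero.1 hzero)

theorem proj_Ioi_proj_Icc_eq_zero (hE : E.Resolves V) (hF : F.Resolves V) (a b : ℝ) (x : H) :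
    F.proj (Set.Ioi b) (E.proj (Set.Icc a b) x) = 0 := by
  rcases lt_or_ge b a with hba | hab
  · rw [Set.Icc_eq_empty_of_lt hba, E.proj_empty, zero_apply, map_zero]
  refine F.proj_eq_zero_of_locally measurableSet_Ioi _ fun t (ht : b < t) =>
    ⟨Set.Icc ((b + t) / 2) (t + 1), mem_nhdsWithin_of_mem_nhds
      (Icc_mem_nhds (by linarith) (by linarith)), measurableSet_Icc, ?_⟩
  have h := hE.proj_Icc_proj_Icc_eq_zero hF (c := (a + b) / 2) (r := (b - a) / 2)
    (a := (b + t) / 2) (by linarith) (by linarith) (t + 1) x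
  rwa [show (a + b) / 2 - (b - a) / 2 = a by ring, show (a + b) / 2 + (b - a) / 2 = b by ring] at h

theorem proj_Iic_proj_Ioi_eq_zero (hE : E.Resolves V) (hF : F.Resolves V) (b : ℝ) (x : H) :
    E.proj (Set.Iic b) (F.proj (Set.Ioi b) x) = 0 :=
  E.proj_eq_zero_of_locally measurableSet_Iic _ fun t _ =>
    ⟨Set.Icc (t - 1) b, by
      rw [← Set.Ici_inter_Iic]
      exact Filter.inter_mem (mem_nhdsWithin_of_mem_nhds (Ici_mem_nhds (by simp)))
        self_mem_nhdsWithin, measurableSet_Icc,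
      proj_proj_eq_zero_comm measurableSet_Icc measurableSet_Ioi
        (hE.proj_Ioi_proj_Icc_eq_zero hF (t - 1) b) x⟩

theorem proj_Iic_eq (hE : E.Resolves V) (hF : F.Resolves V) (b : ℝ) (x : H) :
    E.proj (Set.Iic b) x = F.proj (Set.Iic b) x := by
  have h : E.proj (Set.Ioi b) (F.proj (Set.Iic b) x) = 0 :=
    proj_proj_eq_zero_comm measurableSet_Ioi measurableSet_Iic
      (hF.proj_Iic_proj_Ioi_eq_zero hE b) x
  calc E.proj (Set.Iic b) x
      = E.proj (Set.Iic b) (F.proj (Set.Iic b) x + F.proj (Set.Iic b)ᶜ x) := by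
        rw [F.proj_add_proj_compl measurableSet_Iic]
    _ = E.proj (Set.Iic b) (F.proj (Set.Iic b) x) +
          E.proj (Set.Iic b)ᶜ (F.proj (Set.Iic b) x) := by
        rw [map_add, Set.compl_Iic, hE.proj_Iic_proj_Ioi_eq_zero hF, h]
    _ = F.proj (Set.Iic b) x := E.proj_add_proj_compl measurableSet_Iic _

theorem measure_eq (hE : E.Resolves V) (hF : F.Resolves V) (x : H) :
    E.measure x = F.measure x :=
  Measure.ext_of_Iic _ _ fun b => by
    rw [E.measure_apply x measurableSet_Iic, F.measure_apply x measurableSet_Iic,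
      hE.proj_Iic_eq hF]

theorem borelCalculus_eq (hE : E.Resolves V) {g : ℝ → ℂ} {B : H →L[ℂ] H}
    (hB : ∀ x, Integrable g (E.measure x) ∧ inner ℂ x (B x) = ∫ t, g t ∂(E.measure x)) :
    borelCalculus V g = B := by
  have hex : ∃ B, IsBorelCalculus V g B := ⟨B, E, hE, hB⟩
  rw [borelCalculus, dif_pos hex]
  obtain ⟨F, hF, hC⟩ := hex.choose_spec
  refine ContinuousLinearMap.coe_injective ((ext_inner_map _ _).1 fun x => ?_)
  have hx : inner ℂ x (hex.choose x) = inner ℂ x (B x) := by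
    rw [(hC x).2, (hB x).2, hE.measure_eq hF]
  rw [ContinuousLinearMap.coe_coe, ContinuousLinearMap.coe_coe, ← inner_conj_symm, hx,
    inner_conj_symm]

end ProjectionValuedMeasure.Resolves
end SpectralMeasure

/-! ### Multiplication operators -/

section Multiplication

variable {X : Type*} [MeasurableSpace X] {ν : Measure X} {g g' : X → ℂ}

open Classical in
variable (ν) in
/-- Multiplication by an essentially bounded function `g`, as a bounded operator on `L²(ν)`; the
junk value is `0` if `g` is not essentially bounded. -/
noncomputable def mulOp (g : X → ℂ) : Lp ℂ 2 ν →L[ℂ] Lp ℂ 2 ν :=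
  if h : MemLp g ⊤ ν then (ContinuousLinearMap.mul ℂ ℂ).holderL ν ⊤ 2 2 (h.toLp g) else 0

theorem coeFn_mulOp (hg : MemLp g ⊤ ν) (f : Lp ℂ 2 ν) : mulOp ν g f =ᵐ[ν] fun x => g x * f x := by
  rw [mulOp, dif_pos hg]
  filter_upwards [(ContinuousLinearMap.mul ℂ ℂ).coeFn_holder (r := 2) (hg.toLp g) f,
    hg.coeFn_toLp] with x hholder htoLp
  rw [← htoLp]
  exact hholder

theorem mulOp_congr (h : g =ᵐ[ν] g') : mulOp ν g = mulOp ν g' := by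
  by_cases hg : MemLp g ⊤ ν
  · have hg' := hg.ae_eq h
    ext1 f
    apply Lp.ext
    filter_upwards [coeFn_mulOp hg f, coeFn_mulOp hg' f, h] with x hx hx' hgg'
    rw [hx, hx', hgg']
  · have hg' : ¬ MemLp g' ⊤ ν := fun h' => hg (h'.ae_eq h.symm)
    rw [mulOp, mulOp, dif_neg hg, dif_neg hg']

theorem mulOp_mul (hg : MemLp g ⊤ ν) (hg' : MemLp g' ⊤ ν) :
    mulOp ν (fun x => g x * g' x) = mulOp ν g * mulOp ν g' := by
  ext1 f
  apply Lp.ext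
  rw [mul_apply_eq_comp]
  filter_upwards [coeFn_mulOp (hg'.mul' hg) f, coeFn_mulOp hg (mulOp ν g' f), coeFn_mulOp hg' f]
    with x hmul hx hx'
  rw [hmul, hx, hx', mul_assoc]

theorem mulOp_const (c : ℂ) : mulOp ν (fun _ => c) = c • (1 : Lp ℂ 2 ν →L[ℂ] Lp ℂ 2 ν) := by
  ext1 f
  apply Lp.ext
  filter_upwards [coeFn_mulOp (memLp_top_const c) f, Lp.coeFn_smul c f] with x hmul hsmul
  rw [hmul]
  exact hsmul.symm

theorem mulOp_add (hg : MemLp g ⊤ ν) (hg' : MemLp g' ⊤ ν) :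
    mulOp ν (g + g') = mulOp ν g + mulOp ν g' := by
  ext1 f
  apply Lp.ext
  filter_upwards [coeFn_mulOp (hg.add hg') f, Lp.coeFn_add (mulOp ν g f) (mulOp ν g' f),
    coeFn_mulOp hg f, coeFn_mulOp hg' f] with x hmul hadd hx hx'
  rw [hmul, Pi.add_apply, add_mul, ← hx, ← hx']
  exact hadd.symm

theorem mulOp_sub (hg : MemLp g ⊤ ν) (hg' : MemLp g' ⊤ ν) :
    mulOp ν (g - g') = mulOp ν g - mulOp ν g' := by
  rw [eq_sub_iff_add_eq, ← mulOp_add (hg.sub hg') hg', sub_add_cancel]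

theorem inner_mulOp (hg : MemLp g ⊤ ν) (f f' : Lp ℂ 2 ν) :
    inner ℂ f (mulOp ν g f') = ∫ x, g x * inner ℂ (f x) (f' x) ∂ν := by
  rw [L2.inner_def]
  refine integral_congr_ae ?_
  filter_upwards [coeFn_mulOp hg f'] with x hx
  rw [hx]
  simp only [RCLike.inner_apply]
  ring

theorem star_mulOp (hg : MemLp g ⊤ ν) : star (mulOp ν g) = mulOp ν (star g) := by
  rw [ContinuousLinearMap.star_eq_adjoint, eq_comm, ContinuousLinearMap.eq_adjoint_iff]
  intro f f'
  rw [inner_mulOp hg, L2.inner_def]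
  refine integral_congr_ae ?_
  filter_upwards [coeFn_mulOp hg.star f] with x hx
  rw [hx]
  simp only [RCLike.inner_apply, map_mul, Pi.star_apply, RCLike.star_def,
    RingHomCompTriple.comp_apply, RingHom.id_apply]
  ring

theorem isStarNormal_mulOp (hg : MemLp g ⊤ ν) : IsStarNormal (mulOp ν g) := by
  refine ⟨?_⟩
  rw [star_mulOp hg, Commute, SemiconjBy, ← mulOp_mul hg hg.star, ← mulOp_mul hg.star hg]
  simp_rw [mul_comm]

theorem isUnit_mulOp (hg : MemLp g ⊤ ν) {ε : ℝ} (hε : 0 < ε) (h : ∀ᵐ x ∂ν, ε ≤ ‖g x‖) :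
    IsUnit (mulOp ν g) := by
  have hinv : MemLp (fun x => (g x)⁻¹) ⊤ ν := by
    refine memLp_top_of_bound (C := ε⁻¹) hg.1.inv₀ ?_
    filter_upwards [h] with x hx
    rw [norm_inv]
    exact inv_anti₀ hε hx
  have hcancel : (fun x => g x * (g x)⁻¹) =ᵐ[ν] fun _ => (1 : ℂ) := by
    filter_upwards [h] with x hx
    exact mul_inv_cancel₀ (norm_pos_iff.1 (hε.trans_le hx))
  have hright : mulOp ν g * mulOp ν (fun x => (g x)⁻¹) = 1 := by
    rw [← mulOp_mul hg hinv, mulOp_congr hcancel, mulOp_const, one_smul]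
  have hleft : mulOp ν (fun x => (g x)⁻¹) * mulOp ν g = 1 := by
    rw [← hright, ← mulOp_mul hg hinv, ← mulOp_mul hinv hg]
    simp_rw [mul_comm]
  exact ⟨⟨_, _, hright, hleft⟩, rfl⟩

theorem norm_mulOp_apply_le (hg : MemLp g ⊤ ν) (f : Lp ℂ 2 ν) {ε : ℝ}
    (h : ∀ᵐ x ∂ν, f x ≠ 0 → ‖g x‖ ≤ ε) : ‖mulOp ν g f‖ ≤ ε * ‖f‖ := by
  refine Lp.norm_le_mul_norm_of_ae_le_mul ?_
  filter_upwards [coeFn_mulOp hg f, h] with x hmul hle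
  rw [hmul, norm_mul]
  by_cases hfx : f x = 0
  · simp only [hfx, norm_zero, mul_zero, le_refl]
  · exact mul_le_mul_of_nonneg_right (hle hfx) (norm_nonneg _)

theorem exists_ne_zero_norm_mulOp_apply_le [SigmaFinite ν] (hg : MemLp g ⊤ ν) {ε : ℝ}
    (h : 0 < ν {x | ‖g x‖ < ε}) : ∃ f : Lp ℂ 2 ν, f ≠ 0 ∧ ‖mulOp ν g f‖ ≤ ε * ‖f‖ := by
  have hnull : NullMeasurableSet {x | ‖g x‖ < ε} ν :=
    nullMeasurableSet_lt hg.1.norm.aemeasurable aemeasurable_const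
  obtain ⟨s, hsub, hs, hae⟩ := hnull.exists_measurable_subset_ae_eq
  obtain ⟨t, ht, hts, hpos, hfin⟩ :=
    Measure.exists_subset_measure_lt_top hs ((measure_congr hae).symm ▸ h)
  refine ⟨indicatorConstLp 2 ht hfin.ne (1 : ℂ), ?_, norm_mulOp_apply_le hg _ ?_⟩
  · rw [← norm_pos_iff, norm_indicatorConstLp (by norm_num) (by norm_num), norm_one, one_mul]
    exact Real.rpow_pos_of_pos (ENNReal.toReal_pos hpos.ne' hfin.ne) _
  · filter_upwards [indicatorConstLp_coeFn (p := 2) (hs := ht) (hμs := hfin.ne) (c := (1 : ℂ))]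
      with x hx hx0
    rw [hx] at hx0
    exact (hsub (hts (Set.mem_of_indicator_ne_zero hx0))).le

theorem not_isUnit_mulOp [SigmaFinite ν] (hg : MemLp g ⊤ ν)
    (h : ∀ ε > 0, 0 < ν {x | ‖g x‖ < ε}) : ¬ IsUnit (mulOp ν g) := by
  rintro ⟨u, hu⟩
  set B : Lp ℂ 2 ν →L[ℂ] Lp ℂ 2 ν := ↑u⁻¹
  obtain ⟨ε, hε, hBε⟩ := exists_pos_mul_lt one_pos ‖B‖
  obtain ⟨f, hf, hle⟩ := exists_ne_zero_norm_mulOp_apply_le hg (h ε hε)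
  have hinv : B (mulOp ν g f) = f := by
    rw [← hu, ← mul_apply_eq_comp, u.inv_mul, one_apply_eq_self]
  have hlt : ‖f‖ < ‖f‖ := calc
    ‖f‖ = ‖B (mulOp ν g f)‖ := by rw [hinv]
    _ ≤ ‖B‖ * (ε * ‖f‖) := B.le_opNorm_of_le hle
    _ = ‖B‖ * ε * ‖f‖ := (mul_assoc _ _ _).symm
    _ < 1 * ‖f‖ := by gcongr
    _ = ‖f‖ := one_mul _
  exact hlt.false

theorem mem_spectrum_mulOp_iff [SigmaFinite ν] (hg : MemLp g ⊤ ν) (z : ℂ) :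
    z ∈ spectrum ℂ (mulOp ν g) ↔ ∀ ε > 0, 0 < ν {x | ‖z - g x‖ < ε} := by
  have hz : MemLp (fun _ : X => z) ⊤ ν := memLp_top_const z
  rw [spectrum.mem_iff, Algebra.algebraMap_eq_smul_one, ← mulOp_const, ← mulOp_sub hz hg]
  refine ⟨fun h => ?_, not_isUnit_mulOp (hz.sub hg)⟩
  by_contra! hne
  obtain ⟨ε, hε, hzero⟩ := hne
  refine h (isUnit_mulOp (hz.sub hg) hε ?_)
  simpa only [ae_iff, not_le, Pi.sub_apply, nonpos_iff_eq_zero] using hzero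

variable (ν) in
/-- Multiplication by the indicator function of `A` on `L²(ν)`: the orthogonal projection onto the
functions that vanish outside `A`. -/
noncomputable def indicatorOp (A : Set X) : Lp ℂ 2 ν →L[ℂ] Lp ℂ 2 ν :=
  mulOp ν (A.indicator 1)

variable {A B : Set X}

theorem memLp_indicator_one (hA : MeasurableSet A) : MemLp (A.indicator (1 : X → ℂ)) ⊤ ν :=
  (memLp_top_const 1).indicator hA

theorem indicatorOp_empty : indicatorOp ν (∅ : Set X) = 0 := by
  rw [indicatorOp, Set.indicator_empty']
  exact (mulOp_const 0).trans (zero_smul ℂ _)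

theorem indicatorOp_univ : indicatorOp ν (Set.univ : Set X) = 1 := by
  rw [indicatorOp, Set.indicator_univ]
  exact (mulOp_const 1).trans (one_smul ℂ _)

theorem indicatorOp_inter (hA : MeasurableSet A) (hB : MeasurableSet B) :
    indicatorOp ν (A ∩ B) = indicatorOp ν A * indicatorOp ν B := by
  rw [indicatorOp, Set.inter_indicator_one]
  exact mulOp_mul (memLp_indicator_one hA) (memLp_indicator_one hB)

theorem isStarProjection_indicatorOp (hA : MeasurableSet A) :
    IsStarProjection (indicatorOp ν A) := by
  refine ⟨?_, ?_⟩
  · rw [IsIdempotentElem, ← indicatorOp_inter hA hA, Set.inter_self]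
  · rw [IsSelfAdjoint, indicatorOp, star_mulOp (memLp_indicator_one hA)]
    congr 1
    ext x
    by_cases hx : x ∈ A <;> simp [hx]

theorem indicatorOp_union (hA : MeasurableSet A) (hB : MeasurableSet B) (hAB : Disjoint A B) :
    indicatorOp ν (A ∪ B) = indicatorOp ν A + indicatorOp ν B := by
  rw [indicatorOp, Set.indicator_union_of_disjoint hAB]
  exact mulOp_add (memLp_indicator_one hA) (memLp_indicator_one hB)

theorem indicatorOp_biUnion {s : ℕ → Set X} (hs : ∀ n, MeasurableSet (s n))
    (hd : Pairwise (Function.onFun Disjoint s)) (F : Finset ℕ) :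
    indicatorOp ν (⋃ n ∈ F, s n) = ∑ n ∈ F, indicatorOp ν (s n) := by
  classical
  induction F using Finset.induction_on with
  | empty => simp [indicatorOp_empty]
  | insert a F ha ih =>
    have hdis : Disjoint (s a) (⋃ n ∈ F, s n) :=
      Set.disjoint_iUnion₂_right.2 fun n hn => hd (ne_of_mem_of_not_mem hn ha).symm
    rw [Finset.sum_insert ha, ← ih, Finset.set_biUnion_insert,
      indicatorOp_union (hs a) (F.measurableSet_biUnion fun n _ => hs n) hdis]

end Multiplication

section SqDensity

variable {X : Type*} [MeasurableSpace X] {ν : Measure X}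

/-- The finite measure `|f|² ν` attached to `f ∈ L²(ν)`. -/
noncomputable def sqDensity (f : Lp ℂ 2 ν) : Measure X :=
  ν.withDensity fun x => ((‖f x‖₊ ^ 2 : NNReal) : ENNReal)

theorem sqDensity_absolutelyContinuous (f : Lp ℂ 2 ν) : sqDensity f ≪ ν :=
  withDensity_absolutelyContinuous _ _

theorem aemeasurable_nnnorm_sq (f : Lp ℂ 2 ν) : AEMeasurable (fun x => ‖f x‖₊ ^ 2) ν :=
  (Lp.aestronglyMeasurable f).aemeasurable.nnnorm.pow_const 2

theorem integral_sqDensity (f : Lp ℂ 2 ν) (g : X → ℂ) :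
    ∫ x, g x ∂(sqDensity f) = ∫ x, g x * inner ℂ (f x) (f x) ∂ν := by
  rw [sqDensity, integral_withDensity_eq_integral_smul₀ (aemeasurable_nnnorm_sq f)]
  refine integral_congr_ae (ae_of_all _ fun x => ?_)
  simp [NNReal.smul_def, inner_self_eq_norm_sq_to_K, mul_comm]

theorem integrable_sqDensity_iff (f : Lp ℂ 2 ν) {E : Type*} [NormedAddCommGroup E]
    [NormedSpace ℝ E] (g : X → E) :
    Integrable g (sqDensity f) ↔ Integrable (fun x => (‖f x‖ ^ 2) • g x) ν := by
  rw [sqDensity, integrable_withDensity_iff_integrable_smul₀ (aemeasurable_nnnorm_sq f)]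
  simp only [NNReal.smul_def, NNReal.coe_pow, coe_nnnorm]

theorem ofReal_norm_sq_eq_lintegral (f : Lp ℂ 2 ν) :
    ENNReal.ofReal (‖f‖ ^ 2) = ∫⁻ x, ‖f x‖ₑ ^ 2 ∂ν := by
  rw [ENNReal.ofReal_pow (norm_nonneg _), ofReal_norm, Lp.enorm_def,
    eLpNorm_eq_lintegral_rpow_enorm_toReal (by norm_num) (by norm_num), ← ENNReal.rpow_natCast,
    ← ENNReal.rpow_mul]
  simp

theorem sqDensity_apply (f : Lp ℂ 2 ν) {A : Set X} (hA : MeasurableSet A) :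
    sqDensity f A = ENNReal.ofReal (‖indicatorOp ν A f‖ ^ 2) := by
  rw [sqDensity, withDensity_apply _ hA, ofReal_norm_sq_eq_lintegral, ← lintegral_indicator hA]
  refine lintegral_congr_ae ?_
  filter_upwards [coeFn_mulOp (memLp_indicator_one hA) f] with x hx
  rw [indicatorOp, hx]
  by_cases hxA : x ∈ A <;> simp [hxA, enorm_eq_nnnorm]

instance isFiniteMeasure_sqDensity (f : Lp ℂ 2 ν) : IsFiniteMeasure (sqDensity f) :=
  ⟨by rw [sqDensity_apply f .univ]; exact ENNReal.ofReal_lt_top⟩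

theorem tendsto_sqDensity_iUnion_sdiff_biUnion (f : Lp ℂ 2 ν) {s : ℕ → Set X}
    (hs : ∀ n, MeasurableSet (s n)) :
    Tendsto (fun F : Finset ℕ => sqDensity f ((⋃ n, s n) \ ⋃ n ∈ F, s n)) atTop (𝓝 0) := by
  have hmeas (F : Finset ℕ) : MeasurableSet ((⋃ n, s n) \ ⋃ n ∈ F, s n) :=
    (MeasurableSet.iUnion hs).diff (F.measurableSet_biUnion fun n _ => hs n)
  have hanti : Antitone fun F : Finset ℕ => (⋃ n, s n) \ ⋃ n ∈ F, s n := fun F G hFG =>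
    Set.sdiff_subset_sdiff_right (Set.biUnion_subset_biUnion_left hFG)
  have hempty : ⋂ F : Finset ℕ, (⋃ n, s n) \ ⋃ n ∈ F, s n = ∅ := by
    rw [← Set.sdiff_iUnion, Set.sdiff_eq_empty]
    exact Set.iUnion_subset fun n => (Set.subset_biUnion_of_mem (Finset.mem_singleton_self n)).trans
      (Set.subset_iUnion (fun F : Finset ℕ => ⋃ n ∈ F, s n) {n})
  have hlim := tendsto_measure_iInter_atTop (fun F => (hmeas F).nullMeasurableSet) hanti
    ⟨∅, measure_ne_top (sqDensity f) _⟩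
  rwa [hempty, measure_empty] at hlim

theorem hasSum_indicatorOp_iUnion {s : ℕ → Set X} (hs : ∀ n, MeasurableSet (s n))
    (hd : Pairwise (Function.onFun Disjoint s)) (f : Lp ℂ 2 ν) :
    HasSum (fun n => indicatorOp ν (s n) f) (indicatorOp ν (⋃ n, s n) f) := by
  have hdist (F : Finset ℕ) : ‖indicatorOp ν (⋃ n, s n) f - ∑ n ∈ F, indicatorOp ν (s n) f‖ =
      √(sqDensity f ((⋃ n, s n) \ ⋃ n ∈ F, s n)).toReal := by
    have hF : MeasurableSet (⋃ n ∈ F, s n) := F.measurableSet_biUnion fun n _ => hs n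
    have hsub : (⋃ n ∈ F, s n) ⊆ ⋃ n, s n := Set.iUnion₂_subset_iUnion _ _
    have hsplit := indicatorOp_union (ν := ν) hF ((MeasurableSet.iUnion hs).diff hF)
      Set.disjoint_sdiff_right
    rw [Set.union_sdiff_cancel hsub, indicatorOp_biUnion hs hd] at hsplit
    rw [sqDensity_apply f ((MeasurableSet.iUnion hs).diff hF), ENNReal.toReal_ofReal (sq_nonneg _),
      Real.sqrt_sq (norm_nonneg _), hsplit, _root_.add_apply, _root_.sum_apply, add_sub_cancel_left]
  rw [HasSum, SummationFilter.unconditional_filter, tendsto_iff_norm_sub_tendsto_zero]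
  simp only [norm_sub_rev _ (indicatorOp ν (⋃ n, s n) f), hdist]
  simpa using ((ENNReal.tendsto_toReal ENNReal.zero_ne_top).comp
    (tendsto_sqDensity_iUnion_sdiff_biUnion f hs)).sqrt

end SqDensity

/-! ### Borel functions of an operator that is unitarily equivalent to a multiplication operator -/

section MulModel

variable {X : Type*} [MeasurableSpace X] {ν : Measure X} {m : X → ℝ}
variable {H : Type*} [NormedAddCommGroup H] [InnerProductSpace ℂ H]
variable {V : H →ₗ.[ℂ] H} {U : H ≃ₗᵢ[ℂ] Lp ℂ 2 ν}

/-- The unitary `U` transforms `V` into multiplication by the real function `m`, with maximal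
domain. -/
def IsMulModel (V : H →ₗ.[ℂ] H) (U : H ≃ₗᵢ[ℂ] Lp ℂ 2 ν) (m : X → ℝ) : Prop :=
  ∀ x y : H, (x, y) ∈ V.graph ↔ ∀ᵐ ξ ∂ν, U y ξ = m ξ * U x ξ

namespace IsMulModel

theorem mem_domain_iff_memLp (hV : IsMulModel V U m) (x : H) :
    x ∈ V.domain ↔ MemLp (fun ξ => (m ξ : ℂ) * U x ξ) 2 ν := by
  rw [LinearPMap.mem_domain_iff]
  refine ⟨fun ⟨y, hy⟩ => (Lp.memLp (U y)).ae_eq ((hV x y).1 hy), fun h => ?_⟩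
  refine ⟨U.symm (h.toLp _), (hV _ _).2 ?_⟩
  rw [LinearIsometryEquiv.apply_symm_apply]
  exact h.coeFn_toLp

theorem mem_domain_iff_integrable (hV : IsMulModel V U m) (hm : Measurable m) (x : H) :
    x ∈ V.domain ↔ Integrable (fun t : ℝ => t ^ 2) ((sqDensity (U x)).map m) := by
  have hmeas : AEStronglyMeasurable (fun ξ => (m ξ : ℂ) * U x ξ) ν :=
    (Complex.measurable_ofReal.comp hm).aestronglyMeasurable.mul (Lp.aestronglyMeasurable _)
  rw [hV.mem_domain_iff_memLp, memLp_two_iff_integrable_sq_norm hmeas,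
    integrable_map_measure (by fun_prop) hm.aemeasurable, integrable_sqDensity_iff]
  refine integrable_congr (ae_of_all _ fun ξ => ?_)
  simp only [Function.comp, smul_eq_mul, norm_mul, Complex.norm_real, Real.norm_eq_abs, mul_pow,
    sq_abs]
  ring

end IsMulModel

variable [CompleteSpace H]

/-- The resolution of the identity `s ↦ U⁻¹ 1_{m⁻¹ s} U` of the multiplication operator by `m`,
transported along the unitary `U`. -/
noncomputable def mulPVM (U : H ≃ₗᵢ[ℂ] Lp ℂ 2 ν) (m : X → ℝ) (hm : Measurable m) :
    ProjectionValuedMeasure H where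
  proj s := U.conjStarAlgEquiv.symm (indicatorOp ν (m ⁻¹' s))
  isStarProjection s hs := (isStarProjection_indicatorOp (hm hs)).map U.conjStarAlgEquiv.symm
  proj_univ := by rw [Set.preimage_univ, indicatorOp_univ, map_one]
  proj_inter s t hs ht := by rw [Set.preimage_inter, indicatorOp_inter (hm hs) (hm ht), map_mul]
  hasSum_iUnion s hs hd x := by
    rw [Set.preimage_iUnion]
    exact (hasSum_indicatorOp_iUnion (fun n => hm (hs n)) (fun i j hij => (hd hij).preimage m)
      (U x)).mapL (U.symm.toContinuousLinearEquiv : Lp ℂ 2 ν →L[ℂ] H)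

theorem mulPVM_measure (U : H ≃ₗᵢ[ℂ] Lp ℂ 2 ν) (hm : Measurable m) (x : H) :
    (mulPVM U m hm).measure x = (sqDensity (U x)).map m := by
  ext s hs
  rw [ProjectionValuedMeasure.measure_apply _ x hs, Measure.map_apply hm hs,
    sqDensity_apply _ (hm hs), ← U.symm.norm_map]
  rfl

namespace IsMulModel

theorem resolves_mulPVM (hV : IsMulModel V U m) (hm : Measurable m) :
    (mulPVM U m hm).Resolves V := by
  refine ⟨fun x => by rw [mulPVM_measure, hV.mem_domain_iff_integrable hm], fun x => ?_⟩
  rw [mulPVM_measure, integral_map hm.aemeasurable (by fun_prop), integral_sqDensity,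
    ← U.inner_map_map, L2.inner_def]
  refine integral_congr_ae ?_
  filter_upwards [(hV x (V x)).1 (V.mem_graph x)] with ξ hξ
  rw [hξ]
  simp only [RCLike.inner_apply]
  ring

theorem borelCalculus_eq (hV : IsMulModel V U m) (hm : Measurable m) {g : ℝ → ℂ}
    (hg : Measurable g) (hgm : MemLp (fun ξ => g (m ξ)) ⊤ ν) :
    borelCalculus V g = U.conjStarAlgEquiv.symm (mulOp ν fun ξ => g (m ξ)) := by
  refine (hV.resolves_mulPVM hm).borelCalculus_eq fun x => ?_
  rw [mulPVM_measure, integrable_map_measure hg.aestronglyMeasurable hm.aemeasurable,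
    integral_map hm.aemeasurable hg.aestronglyMeasurable, integral_sqDensity, ← inner_mulOp hgm,
    ← U.inner_map_map x]
  refine ⟨?_, congrArg _ (U.apply_symm_apply _)⟩
  have hac := sqDensity_absolutelyContinuous (U x)
  have hbdd : MemLp (fun ξ => g (m ξ)) ⊤ (sqDensity (U x)) := by
    refine ⟨hgm.1.mono_ac hac, lt_of_le_of_lt ?_ hgm.2⟩
    simpa only [eLpNorm_exponent_top] using eLpNormEssSup_mono_measure _ hac
  exact hbdd.integrable le_top

end IsMulModel

end MulModel

/-! ### Locally absolutely continuous functions and weak derivatives -/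

section AbsoluteContinuity

open scoped ContDiff

variable {F : Type*} [NormedAddCommGroup F] [NormedSpace ℝ F] {u h : ℝ → F}

theorem absolutelyContinuousOnInterval_of_dist_le {X Y : Type*} [PseudoMetricSpace X]
    [PseudoMetricSpace Y] {f : ℝ → X} {g : ℝ → Y} {a b : ℝ}
    (hg : AbsolutelyContinuousOnInterval g a b)
    (hfg : ∀ x y, dist (f x) (f y) ≤ dist (g x) (g y)) :
    AbsolutelyContinuousOnInterval f a b := by
  rw [absolutelyContinuousOnInterval_iff] at hg ⊢
  intro ε hε
  obtain ⟨δ, hδ, hgδ⟩ := hg ε hε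
  exact ⟨δ, hδ, fun E hE hlen =>
    (Finset.sum_le_sum fun i _ => hfg _ _).trans_lt (hgδ E hE hlen)⟩

theorem absolutelyContinuousOnInterval_integral (hh : LocallyIntegrable h) (c a b : ℝ) :
    AbsolutelyContinuousOnInterval (fun x => ∫ t in c..x, h t) a b := by
  have hint : ∀ x y : ℝ, IntervalIntegrable h volume x y := fun x y =>
    (hh.integrableOn_isCompact isCompact_uIcc).intervalIntegrable
  have hc : c ∈ Set.uIcc (min c (min a b)) (max c (max a b)) :=
    Set.mem_uIcc.2 (.inl ⟨min_le_left _ _, le_max_left _ _⟩)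
  have hnorm : AbsolutelyContinuousOnInterval (fun x => ∫ t in c..x, ‖h t‖) a b :=
    ((hint _ _).norm.absolutelyContinuousOnInterval_intervalIntegral hc).mono
      ((Set.Icc_subset_Icc (min_le_right _ _) (le_max_right _ _)).trans Set.Icc_subset_uIcc)
  refine absolutelyContinuousOnInterval_of_dist_le hnorm fun x y => ?_
  rw [dist_eq_norm, Real.dist_eq, intervalIntegral.integral_interval_sub_left (hint c x) (hint c y),
    intervalIntegral.integral_interval_sub_left (hint c x).norm (hint c y).norm]
  exact intervalIntegral.norm_integral_le_abs_integral_norm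

/-- `u` is locally absolutely continuous on `ℝ`, with derivative `h` almost everywhere. -/
def IsACPrimitive (u h : ℝ → F) : Prop :=
  (∀ a b : ℝ, AbsolutelyContinuousOnInterval u a b) ∧ ∀ᵐ t : ℝ, HasDerivAt u (h t) t

namespace IsACPrimitive

protected theorem continuous (hu : IsACPrimitive u h) : Continuous u := by
  rw [continuous_iff_continuousAt]
  intro t
  refine (hu.1 (t - 1) (t + 1)).continuousOn.continuousAt ?_
  rw [Set.uIcc_of_le (by linarith)]
  exact Icc_mem_nhds (by linarith) (by linarith)

protected theorem const (C : F) : IsACPrimitive (fun _ => C) 0 :=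
  ⟨fun _ _ => contDiff_const.contDiffOn.absolutelyContinuousOnInterval,
    ae_of_all _ fun t => hasDerivAt_const t C⟩

protected theorem add {v k : ℝ → F} (hu : IsACPrimitive u h) (hv : IsACPrimitive v k) :
    IsACPrimitive (u + v) (h + k) :=
  ⟨fun a b => (hu.1 a b).add (hv.1 a b), by
    filter_upwards [hu.2, hv.2] with t hut hvt using hut.add hvt⟩

theorem intervalIntegral [CompleteSpace F] (hh : LocallyIntegrable h) (c : ℝ) :
    IsACPrimitive (fun x => ∫ t in c..x, h t) h :=
  ⟨absolutelyContinuousOnInterval_integral hh c, by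
    filter_upwards [LocallyIntegrable.ae_hasDerivAt_integral hh] with t ht using ht c⟩

protected theorem smul {𝕜 : Type*} [RCLike 𝕜] [NormedSpace 𝕜 F] [IsScalarTower ℝ 𝕜 F]
    (hu : IsACPrimitive u h) {θ : ℝ → 𝕜} (hθ : ContDiff ℝ 1 θ) :
    IsACPrimitive (fun t => θ t • u t) fun t => θ t • h t + deriv θ t • u t :=
  ⟨fun a b => hθ.contDiffOn.absolutelyContinuousOnInterval.smul (hu.1 a b), by
    filter_upwards [hu.2] with t ht
    exact (hθ.differentiable one_ne_zero t).hasDerivAt.smul ht⟩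

theorem integral_eq_sub [CompleteSpace F] (hu : IsACPrimitive u h) (hh : LocallyIntegrable h)
    (a b : ℝ) : ∫ t in a..b, h t = u b - u a := by
  obtain ⟨C, hC⟩ := ((hu.1 a b).sub
    (absolutelyContinuousOnInterval_integral hh a a b)).const_of_ae_hasDerivAt_zero (by
      filter_upwards [hu.2, (intervalIntegral hh a).2] with t hut hht _
      simpa using hut.sub hht)
  have hab := (hC a Set.left_mem_uIcc).trans (hC b Set.right_mem_uIcc).symm
  simp only [Pi.sub_apply, intervalIntegral.integral_same, sub_zero] at hab
  rw [hab, sub_sub_cancel]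

theorem integral_eq_zero [CompleteSpace F] (hu : IsACPrimitive u h) (hui : Integrable u)
    (hhi : Integrable h) : ∫ t, h t = 0 := by
  have hint := hu.integral_eq_sub hhi.locallyIntegrable 0
  have htop : u 0 + ∫ t in Set.Ioi 0, h t = 0 := by
    refine IntegrableAtFilter.eq_zero_of_tendsto (hui.integrableAtFilter atTop) (fun s hs => ?_)
      (((intervalIntegral_tendsto_integral_Ioi 0 hhi.integrableOn tendsto_id).const_add
        (u 0)).congr fun x => by rw [id, hint, add_sub_cancel])
    obtain ⟨a, ha⟩ := mem_atTop_sets.1 hs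
    exact measure_mono_top (show Set.Ici a ⊆ s from ha) Real.volume_Ici
  have hbot : u 0 - ∫ t in Set.Iic 0, h t = 0 := by
    refine IntegrableAtFilter.eq_zero_of_tendsto (hui.integrableAtFilter atBot) (fun s hs => ?_)
      (((intervalIntegral_tendsto_integral_Iic 0 hhi.integrableOn tendsto_id).const_sub
        (u 0)).congr fun x => by
          rw [id, intervalIntegral.integral_symm, hint, sub_neg_eq_add, add_sub_cancel])
    obtain ⟨a, ha⟩ := mem_atBot_sets.1 hs
    exact measure_mono_top (show Set.Iic a ⊆ s from ha) Real.volume_Iic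
  rw [← intervalIntegral.integral_Iic_add_Ioi hhi.integrableOn hhi.integrableOn (b := 0),
    ← sub_eq_zero.1 hbot, htop]

theorem integral_deriv_smul [CompleteSpace F] {𝕜 : Type*} [RCLike 𝕜] [NormedSpace 𝕜 F]
    [IsScalarTower ℝ 𝕜 F] (hu : IsACPrimitive u h) {θ : ℝ → 𝕜} (hθ : ContDiff ℝ 1 θ)
    (hθu : Integrable fun t => θ t • u t) (hθh : Integrable fun t => θ t • h t)
    (hdθu : Integrable fun t => deriv θ t • u t) :
    ∫ t, deriv θ t • u t = -∫ t, θ t • h t := by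
  have hsum := (hu.smul hθ).integral_eq_zero hθu (hθh.add hdθu)
  rw [integral_add hθh hdθu, add_comm] at hsum
  exact eq_neg_of_add_eq_zero_left hsum

end IsACPrimitive

/-- `g` agrees almost everywhere with a locally absolutely continuous function whose derivative
is `h`. -/
def HasACDeriv (g h : ℝ → F) : Prop :=
  ∃ u : ℝ → F, g =ᵐ[volume] u ∧ IsACPrimitive u h

/-- `h` is the weak derivative of `g`, tested against smooth functions with compact support. -/
def HasWeakDeriv (g h : ℝ → F) : Prop :=
  ∀ θ : ℝ → ℝ, ContDiff ℝ ∞ θ → HasCompactSupport θ → ∫ t, deriv θ t • g t = -∫ t, θ t • h t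

theorem IsACPrimitive.hasWeakDeriv [CompleteSpace F] (hu : IsACPrimitive u h)
    (hh : LocallyIntegrable h) : HasWeakDeriv u h := fun θ hθ hθc =>
  have hul : LocallyIntegrable u := hu.continuous.locallyIntegrable
  hu.integral_deriv_smul (hθ.of_le (by simp))
    (hul.integrable_smul_left_of_hasCompactSupport hθ.continuous hθc)
    (hh.integrable_smul_left_of_hasCompactSupport hθ.continuous hθc)
    (hul.integrable_smul_left_of_hasCompactSupport (hθ.continuous_deriv (by simp)) hθc.deriv)

theorem exists_contDiff_hasCompactSupport_deriv_eq {k : ℝ → ℝ} (hk : ContDiff ℝ ∞ k)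
    (hkc : HasCompactSupport k) (hk0 : ∫ t, k t = 0) :
    ∃ θ : ℝ → ℝ, ContDiff ℝ ∞ θ ∧ HasCompactSupport θ ∧ deriv θ = k := by
  have hki : Integrable k := hk.continuous.integrable_of_hasCompactSupport hkc
  obtain ⟨R, hR⟩ : ∃ R : ℝ, tsupport k ⊆ Set.Icc (-R) R := by
    obtain ⟨R, hR⟩ := hkc.isCompact.isBounded.subset_closedBall 0
    exact ⟨R, by simpa [Real.closedBall_eq_Icc] using hR⟩
  have hk_out : ∀ t, t ∉ Set.Icc (-R) R → k t = 0 := fun t ht =>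
    image_eq_zero_of_notMem_tsupport fun htk => ht (hR htk)
  have hderiv : ∀ x, HasDerivAt (fun x => ∫ t in Set.Iic x, k t) (k x) x := fun x => by
    have hsplit : (fun y => ∫ t in Set.Iic y, k t) =
        fun y => (∫ t in Set.Iic x, k t) + ∫ t in x..y, k t := funext fun y => by
      rw [← intervalIntegral.integral_Iic_sub_Iic hki.integrableOn hki.integrableOn,
        add_sub_cancel]
    rw [hsplit]
    exact (intervalIntegral.integral_hasDerivAt_right hki.intervalIntegrable
      (hk.continuous.stronglyMeasurableAtFilter _ _) hk.continuous.continuousAt).const_add _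
  have hderiv_eq : deriv (fun x => ∫ t in Set.Iic x, k t) = k := funext fun x => (hderiv x).deriv
  refine ⟨_, ?_, ?_, hderiv_eq⟩
  · exact contDiff_infty_iff_deriv.2 ⟨fun x => (hderiv x).differentiableAt, by rwa [hderiv_eq]⟩
  · refine HasCompactSupport.intro (isCompact_Icc (a := -R) (b := R)) fun x hx => ?_
    rw [Set.mem_Icc, not_and_or, not_le, not_le] at hx
    rcases hx with hx | hx
    · exact setIntegral_eq_zero_of_forall_eq_zero fun t ht =>
        hk_out t fun htR => hx.not_ge (htR.1.trans ht)
    · rw [← hk0]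
      exact setIntegral_eq_integral_of_forall_compl_eq_zero fun t ht =>
        hk_out t fun htR => ht (htR.2.trans hx.le)

/-- The lemma of du Bois-Reymond. -/
theorem HasWeakDeriv.exists_ae_eq_const [CompleteSpace F] (hu : LocallyIntegrable u)
    (hu0 : HasWeakDeriv u 0) : ∃ C : F, u =ᵐ[volume] fun _ => C := by
  let ρ : ContDiffBump (0 : ℝ) := default
  set r : ℝ → ℝ := ρ.normed volume
  have hr : ContDiff ℝ ∞ r := ρ.contDiff_normed
  have hrc : HasCompactSupport r := ρ.hasCompactSupport_normed
  have hri : Integrable r := hr.continuous.integrable_of_hasCompactSupport hrc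
  have hru : Integrable fun t => r t • u t :=
    hu.integrable_smul_left_of_hasCompactSupport hr.continuous hrc
  refine ⟨∫ t, r t • u t,
    ae_eq_of_integral_contDiff_smul_eq hu (locallyIntegrable_const _) fun ψ hψ hψc => ?_⟩
  set M := ∫ t, ψ t
  have hψi : Integrable ψ := hψ.continuous.integrable_of_hasCompactSupport hψc
  have hψu : Integrable fun t => ψ t • u t :=
    hu.integrable_smul_left_of_hasCompactSupport hψ.continuous hψc
  obtain ⟨θ, hθ, hθc, hθ'⟩ := exists_contDiff_hasCompactSupport_deriv_eq
    (hψ.sub (contDiff_const.mul hr)) (hψc.sub (hrc.mul_left (f := fun _ => M))) (by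
      rw [integral_sub hψi (hri.const_mul M), integral_const_mul, ρ.integral_normed, mul_one,
        sub_self])
  have hsplit : (∫ t, ψ t • u t) - M • ∫ t, r t • u t = 0 := by
    have hθu := hu0 θ hθ hθc
    simp only [hθ', Pi.zero_apply, smul_zero, integral_zero, neg_zero, sub_smul, mul_smul] at hθu
    rwa [integral_sub hψu (g := fun t => M • r t • u t) (hru.smul M), integral_smul] at hθu
  rw [integral_smul_const, sub_eq_zero.1 hsplit]

theorem HasWeakDeriv.hasACDeriv [CompleteSpace F] {g : ℝ → F} (hg : LocallyIntegrable g)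
    (hh : LocallyIntegrable h) (hgh : HasWeakDeriv g h) : HasACDeriv g h := by
  set u : ℝ → F := fun x => ∫ t in (0 : ℝ)..x, h t
  have hu : IsACPrimitive u h := .intervalIntegral hh 0
  have hul : LocallyIntegrable u := hu.continuous.locallyIntegrable
  obtain ⟨C, hC⟩ := HasWeakDeriv.exists_ae_eq_const (hg.sub hul) fun θ hθ hθc => by
    have hθ' : Continuous (deriv θ) := hθ.continuous_deriv (by simp)
    simp only [Pi.sub_apply, smul_sub, Pi.zero_apply, smul_zero, integral_zero, neg_zero]
    rw [integral_sub (hg.integrable_smul_left_of_hasCompactSupport hθ' hθc.deriv)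
      (hul.integrable_smul_left_of_hasCompactSupport hθ' hθc.deriv), hgh θ hθ hθc,
      hu.hasWeakDeriv hh θ hθ hθc, sub_self]
  refine ⟨u + fun _ => C, ?_, by simpa using hu.add (.const C)⟩
  filter_upwards [hC] with t ht
  rw [Pi.add_apply, ← ht, Pi.sub_apply, add_sub_cancel]

theorem HasACDeriv.smul {𝕜 : Type*} [RCLike 𝕜] [NormedSpace 𝕜 F] [IsScalarTower ℝ 𝕜 F]
    {g : ℝ → F} (hgh : HasACDeriv g h) {θ : ℝ → 𝕜} (hθ : ContDiff ℝ 1 θ) :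
    HasACDeriv (fun t => θ t • g t) fun t => θ t • h t + deriv θ t • g t := by
  obtain ⟨u, hgu, hu⟩ := hgh
  refine ⟨fun t => θ t • u t, ?_, (hu.smul hθ).1, ?_⟩
  · filter_upwards [hgu] with t ht using by rw [ht]
  · filter_upwards [hgu, (hu.smul hθ).2] with t ht hut using by rwa [ht]

theorem hasACDeriv_congr {g g' h' : ℝ → F} (hg : g =ᵐ[volume] g') (hh : h =ᵐ[volume] h') :
    HasACDeriv g h ↔ HasACDeriv g' h' := by
  refine exists_congr fun u => and_congr ⟨hg.symm.trans, hg.trans⟩ (and_congr_right fun _ => ?_)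
  refine eventually_congr ?_
  filter_upwards [hh] with t ht using by rw [ht]

end AbsoluteContinuity

/-! ### Derivatives and the Fourier transform -/

section FourierTransform

open scoped SchwartzMap FourierTransform LineDeriv ContDiff

section TestFunctions

theorem exists_schwartz_eq_ofReal {E : Type*} [NormedAddCommGroup E] [NormedSpace ℝ E]
    {θ : E → ℝ} (hθ : ContDiff ℝ ∞ θ) (hθc : HasCompactSupport θ) :
    ∃ Θ : 𝓢(E, ℂ), ∀ t, Θ t = θ t :=
  have hc : HasCompactSupport (Complex.ofRealCLM ∘ θ) := hθc.comp_left rfl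
  ⟨hc.toSchwartzMap (by fun_prop), fun _ => rfl⟩

variable {E F : Type*} [NormedAddCommGroup E] [NormedSpace ℝ E] [MeasurableSpace E] [BorelSpace E]
  {μ : Measure E} [μ.HasTemperateGrowth] [NormedAddCommGroup F] [NormedSpace ℂ F]
  {p : ENNReal} [Fact (1 ≤ p)]

theorem integrable_schwartz_smul [SecondCountableTopology E] (θ : 𝓢(E, ℂ)) (g : Lp F p μ) :
    Integrable (fun t => θ t • g t) μ :=
  have : ENNReal.HolderConjugate p (1 - p⁻¹)⁻¹ :=
    ENNReal.HolderConjugate.inv_one_sub_inv' Fact.out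
  memLp_one_iff_integrable.1 ((Lp.memLp g).smul (θ.memLp (1 - p⁻¹)⁻¹ μ))

theorem smulLeftCLM_toTemperedDistribution_eq_iff [FiniteDimensional ℝ E]
    [IsLocallyFiniteMeasure μ] [CompleteSpace F] {q : E → ℂ} (hq : q.HasTemperateGrowth)
    (g h : Lp F p μ) :
    TemperedDistribution.smulLeftCLM F q (g : 𝓢'(E, F)) = h ↔ ∀ᵐ t ∂μ, h t = q t • g t := by
  have hp : 1 ≤ p := Fact.out
  have happly (θ : 𝓢(E, ℂ)) : TemperedDistribution.smulLeftCLM F q (g : 𝓢'(E, F)) θ =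
      ∫ t, θ t • q t • g t ∂μ := by
    simp only [TemperedDistribution.smulLeftCLM_apply_apply, Lp.toTemperedDistribution_apply,
      SchwartzMap.smulLeftCLM_apply_apply hq, smul_eq_mul, mul_comm (q _), mul_smul]
  constructor
  · intro hgh
    refine ae_eq_of_integral_contDiff_smul_eq ((Lp.memLp h).locallyIntegrable hp)
      (((Lp.memLp g).locallyIntegrable hp).continuous_smul hq.1.continuous) fun θ hθ hθc => ?_
    obtain ⟨Θ, hΘ⟩ := exists_schwartz_eq_ofReal hθ hθc
    have hΘ_eq := congr($hgh Θ)
    rw [happly, Lp.toTemperedDistribution_apply] at hΘ_eq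
    simpa only [hΘ, Complex.coe_smul] using hΘ_eq.symm
  · intro hgh
    ext θ
    rw [happly, Lp.toTemperedDistribution_apply]
    exact integral_congr_ae (by filter_upwards [hgh] with t ht using by rw [ht])

end TestFunctions

theorem lineDerivOp_one_toTemperedDistribution_apply {F : Type*} [NormedAddCommGroup F]
    [NormedSpace ℂ F] [CompleteSpace F] {p : ENNReal} [Fact (1 ≤ p)]
    (g : Lp F p (volume : Measure ℝ)) (θ : 𝓢(ℝ, ℂ)) :
    (∂_{(1 : ℝ)} (g : 𝓢'(ℝ, F))) θ = -∫ t, deriv θ t • g t := by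
  rw [TemperedDistribution.lineDerivOp_apply_apply, map_neg, Lp.toTemperedDistribution_apply]
  simp only [SchwartzMap.lineDerivOp_apply_eq_fderiv, fderiv_apply_one_eq_deriv]

theorem hasACDeriv_iff_lineDerivOp_eq {F : Type*} [NormedAddCommGroup F] [NormedSpace ℂ F]
    [CompleteSpace F] {p : ENNReal} [Fact (1 ≤ p)] (g h : Lp F p (volume : Measure ℝ)) :
    HasACDeriv g h ↔ ∂_{(1 : ℝ)} (g : 𝓢'(ℝ, F)) = h := by
  have hp : 1 ≤ p := Fact.out
  constructor
  · rintro ⟨u, hgu, hu⟩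
    ext θ
    have hsmul {θ : ℝ → ℂ} : (fun t => θ t • g t) =ᵐ[volume] fun t => θ t • u t := by
      filter_upwards [hgu] with t ht using by rw [ht]
    rw [lineDerivOp_one_toTemperedDistribution_apply, Lp.toTemperedDistribution_apply,
      integral_congr_ae hsmul, hu.integral_deriv_smul (θ.smooth 1)
        ((integrable_schwartz_smul θ g).congr hsmul) (integrable_schwartz_smul θ h)
        ((integrable_schwartz_smul (SchwartzMap.derivCLM ℂ ℂ θ) g).congr hsmul), neg_neg]
  · intro hgh
    refine HasWeakDeriv.hasACDeriv ((Lp.memLp g).locallyIntegrable hp)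
      ((Lp.memLp h).locallyIntegrable hp) fun θ hθ hθc => ?_
    obtain ⟨Θ, hΘ⟩ := exists_schwartz_eq_ofReal hθ hθc
    have hΘ' : ∀ t, deriv Θ t = ((deriv θ t : ℝ) : ℂ) := fun t => by
      rw [show (Θ : ℝ → ℂ) = fun t => (θ t : ℂ) from funext hΘ]
      exact (hθ.differentiable (by simp) t).hasDerivAt.ofReal_comp.deriv
    have hΘ_eq := congr($hgh Θ)
    rw [lineDerivOp_one_toTemperedDistribution_apply, Lp.toTemperedDistribution_apply] at hΘ_eq
    simpa only [hΘ, hΘ', Complex.coe_smul] using neg_eq_iff_eq_neg.1 hΘ_eq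

theorem hasACDeriv_iff_fourier {F : Type*} [NormedAddCommGroup F] [InnerProductSpace ℂ F]
    [CompleteSpace F] (g h : Lp F 2 (volume : Measure ℝ)) :
    HasACDeriv g h ↔ ∀ᵐ ξ : ℝ, (𝓕 h : Lp F 2 (volume : Measure ℝ)) ξ =
      (2 * Real.pi * Complex.I * ξ) • (𝓕 g : Lp F 2 (volume : Measure ℝ)) ξ := by
  have hid : (fun ξ : ℝ => (ξ : ℂ)).HasTemperateGrowth := by fun_prop
  have hmul : TemperedDistribution.smulLeftCLM F (fun ξ : ℝ => 2 * Real.pi * Complex.I * ξ) =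
      (2 * Real.pi * Complex.I) • TemperedDistribution.smulLeftCLM F fun ξ : ℝ => (ξ : ℂ) :=
    TemperedDistribution.smulLeftCLM_smul hid _
  rw [hasACDeriv_iff_lineDerivOp_eq, ← smulLeftCLM_toTemperedDistribution_eq_iff (by fun_prop),
    hmul, ← Lp.fourier_toTemperedDistribution_eq, ← Lp.fourier_toTemperedDistribution_eq,
    ← (FourierTransform.fourierEquiv ℂ 𝓢'(ℝ, F)).injective.eq_iff]
  simp [TemperedDistribution.fourier_lineDerivOp_eq]

end FourierTransform

/-! ### Diagonalization of the momentum operator -/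

section Momentum

variable {F : Type*} [NormedAddCommGroup F] [NormedSpace ℝ F]

theorem ae_weight (c : ℝ) : ae (weight c) = ae volume :=
  le_antisymm (withDensity_absolutelyContinuous _ _).ae_le (volume_ac_weight c).ae_le

theorem eLpNorm_weight (c : ℝ) (f : ℝ → F) :
    eLpNorm f 2 (weight c) = eLpNorm (fun t => Real.exp (-c * t) • f t) 2 volume := by
  have density_eq (t : ℝ) :
      ENNReal.ofReal (Real.exp (-2 * c * t)) = ‖Real.exp (-c * t)‖ₑ ^ 2 := by
    rw [Real.enorm_of_nonneg (Real.exp_pos _).le, ← ENNReal.ofReal_pow (Real.exp_pos _).le,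
      ← Real.exp_nat_mul]
    congr 2
    push_cast
    ring
  rw [eLpNorm_eq_lintegral_rpow_enorm_toReal two_ne_zero ENNReal.ofNat_ne_top,
    eLpNorm_eq_lintegral_rpow_enorm_toReal two_ne_zero ENNReal.ofNat_ne_top, weight,
    lintegral_withDensity_eq_lintegral_mul_non_measurable _ (by fun_prop)
      (ae_of_all _ fun t => ENNReal.ofReal_lt_top)]
  simp only [Pi.mul_apply, density_eq, ENNReal.toReal_ofNat, ENNReal.rpow_ofNat, enorm_smul,
    mul_pow]

theorem exp_smul_exp_neg_smul (k t : ℝ) (y : F) :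
    Real.exp (k * t) • Real.exp (-k * t) • y = y := by
  rw [smul_smul, ← Real.exp_add, neg_mul, add_neg_cancel, Real.exp_zero, one_smul]

theorem exp_neg_smul_exp_smul (k t : ℝ) (y : F) :
    Real.exp (-k * t) • Real.exp (k * t) • y = y := by
  simpa only [neg_neg] using exp_smul_exp_neg_smul (-k) t y

theorem memLp_weight_iff (c : ℝ) (f : ℝ → F) :
    MemLp f 2 (weight c) ↔ MemLp (fun t => Real.exp (-c * t) • f t) 2 volume := by
  have aestronglyMeasurable_exp (k : ℝ) :
      AEStronglyMeasurable (fun t : ℝ => Real.exp (k * t)) volume :=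
    Continuous.aestronglyMeasurable (by fun_prop)
  rw [MemLp, MemLp, eLpNorm_weight]
  refine and_congr_left fun _ => ⟨fun hf => ?_, fun hf => ?_⟩
  · exact (aestronglyMeasurable_exp (-c)).smul (hf.mono_ac (volume_ac_weight c))
  · exact (((aestronglyMeasurable_exp c).smul hf).congr
      (ae_of_all _ fun t => exp_smul_exp_neg_smul c t (f t))).mono_ac
      (Measure.ae_le_iff_absolutelyContinuous.1 (ae_weight c).le)

theorem memLp_exp_neg_smul (c : ℝ) (f : HSpace c) :
    MemLp (fun t => Real.exp (-c * t) • f t) 2 volume :=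
  (memLp_weight_iff c f).1 (Lp.memLp f)

/-- The isometry `f ↦ e^{-ct} f` from `ℍ_c` into `L²(ℝ)`, from which `unweight` is built. -/
noncomputable def unweightₗᵢ (c : ℝ) : HSpace c →ₗᵢ[ℂ] Lp ℂ 2 (volume : Measure ℝ) where
  toFun f := (memLp_exp_neg_smul c f).toLp _
  map_add' f g := by
    rw [← MemLp.toLp_add]
    refine MemLp.toLp_congr _ _ ?_
    filter_upwards [(volume_ac_weight c).ae_le (Lp.coeFn_add f g)] with t add_apply
    rw [add_apply, Pi.add_apply, smul_add, Pi.add_apply]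
  map_smul' k f := by
    rw [RingHom.id_apply, ← MemLp.toLp_const_smul]
    refine MemLp.toLp_congr _ _ ?_
    filter_upwards [(volume_ac_weight c).ae_le (Lp.coeFn_smul k f)] with t smul_apply
    rw [smul_apply, Pi.smul_apply, smul_comm, Pi.smul_apply]
  norm_map' f := by
    change ‖(memLp_exp_neg_smul c f).toLp _‖ = ‖f‖
    rw [Lp.norm_toLp, ← eLpNorm_weight, Lp.norm_def]

theorem coeFn_unweightₗᵢ (c : ℝ) (f : HSpace c) :
    unweightₗᵢ c f =ᵐ[volume] fun t => Real.exp (-c * t) • f t :=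
  (memLp_exp_neg_smul c f).coeFn_toLp

theorem unweightₗᵢ_surjective (c : ℝ) : Function.Surjective (unweightₗᵢ c) := by
  intro g
  have hg : MemLp (fun t => Real.exp (c * t) • g t) 2 (weight c) := by
    simpa only [memLp_weight_iff, exp_neg_smul_exp_smul] using Lp.memLp g
  refine ⟨hg.toLp _, Lp.ext ?_⟩
  filter_upwards [coeFn_unweightₗᵢ c (hg.toLp _), (volume_ac_weight c).ae_le hg.coeFn_toLp]
    with t unweight_apply toLp_apply
  rw [unweight_apply, toLp_apply, exp_neg_smul_exp_smul]

/-- The unitary `f ↦ e^{-ct} f` from `ℍ_c` onto `L²(ℝ)`. -/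
noncomputable def unweight (c : ℝ) : HSpace c ≃ₗᵢ[ℂ] Lp ℂ 2 (volume : Measure ℝ) :=
  LinearIsometryEquiv.ofSurjective (unweightₗᵢ c) (unweightₗᵢ_surjective c)

theorem coeFn_unweight (c : ℝ) (f : HSpace c) :
    unweight c f =ᵐ[volume] fun t => Real.exp (-c * t) • f t :=
  coeFn_unweightₗᵢ c f

theorem mem_shiftGraph_iff (c : ℝ) (p : HSpace c × HSpace c) :
    p ∈ shiftGraph c ↔ HasACDeriv p.1 p.2 := by
  change (∃ u : ℝ → ℂ, (∀ a b : ℝ, AbsolutelyContinuousOnInterval u a b) ∧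
    (p.1 : ℝ → ℂ) =ᵐ[weight c] u ∧ ∀ᵐ t ∂(weight c), HasDerivAt u ((p.2 : ℝ → ℂ) t) t) ↔ _
  rw [ae_weight]
  exact exists_congr fun u => and_left_comm

theorem mem_momentum_graph_iff_mem_shiftGraph (c : ℝ) (x y : HSpace c) :
    (x, y) ∈ (momentum c).graph ↔ (x, Complex.I • y + (c : ℂ) • x) ∈ shiftGraph c := by
  rw [← Submodule.toLinearPMap_graph_eq _ (shiftGraph_functional c), LinearPMap.mem_graph_iff,
    LinearPMap.mem_graph_iff]
  refine exists_congr fun z => and_congr_right fun hz : (z : HSpace c) = x => ?_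
  change Complex.I⁻¹ • (-((c : ℂ) • (z : HSpace c)) + infinitesimalShift c z) = y ↔
    infinitesimalShift c z = _
  rw [inv_smul_eq_iff₀ Complex.I_ne_zero, hz, neg_add_eq_sub, sub_eq_iff_eq_add]

theorem HasACDeriv.exp_smul {g h : ℝ → F} (hgh : HasACDeriv g h) (k : ℝ) :
    HasACDeriv (fun t => Real.exp (k * t) • g t)
      fun t => Real.exp (k * t) • (h t + k • g t) := by
  have contDiff_exp : ContDiff ℝ 1 fun t => Real.exp (k * t) := by fun_prop
  have deriv_exp (t : ℝ) : deriv (fun s => Real.exp (k * s)) t = Real.exp (k * t) * k := by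
    simpa using ((hasDerivAt_id t).const_mul k).exp.deriv
  simpa only [deriv_exp, mul_smul, smul_add] using hgh.smul contDiff_exp

theorem hasACDeriv_exp_smul_iff {g h : ℝ → F} (k : ℝ) :
    HasACDeriv (fun t => Real.exp (k * t) • g t)
      (fun t => Real.exp (k * t) • (h t + k • g t)) ↔ HasACDeriv g h := by
  refine ⟨fun hgh => ?_, fun hgh => hgh.exp_smul k⟩
  simpa only [smul_comm (-k), ← smul_add, exp_neg_smul_exp_smul, neg_smul, add_neg_cancel_right]
    using hgh.exp_smul (-k)

theorem mem_momentum_graph_iff (c : ℝ) (x y : HSpace c) :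
    (x, y) ∈ (momentum c).graph ↔ HasACDeriv (unweight c x) (unweight c (Complex.I • y)) := by
  rw [mem_momentum_graph_iff_mem_shiftGraph, mem_shiftGraph_iff,
    ← hasACDeriv_exp_smul_iff (-c)]
  refine hasACDeriv_congr (coeFn_unweight c x).symm ?_
  filter_upwards [coeFn_unweight c (Complex.I • y),
    (volume_ac_weight c).ae_le (Lp.coeFn_add (Complex.I • y) ((c : ℂ) • x)),
    (volume_ac_weight c).ae_le (Lp.coeFn_smul (c : ℂ) x)] with t unweight_apply add_apply smul_apply
  rw [unweight_apply, add_apply, Pi.add_apply, smul_apply, Pi.smul_apply, Complex.coe_smul,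
    neg_smul, add_neg_cancel_right]

/-- The unitary `f ↦ 𝓕 (e^{-ct} f)` from `ℍ_c` onto `L²(ℝ)`, which diagonalizes `V_c`. -/
noncomputable def momentumUnitary (c : ℝ) : HSpace c ≃ₗᵢ[ℂ] Lp ℂ 2 (volume : Measure ℝ) :=
  (unweight c).trans (Lp.fourierTransformₗᵢ ℝ ℂ)

theorem isMulModel_momentum (c : ℝ) :
    IsMulModel (momentum c) (momentumUnitary c) fun ξ => 2 * Real.pi * ξ := by
  intro x y
  rw [mem_momentum_graph_iff, hasACDeriv_iff_fourier]
  change (∀ᵐ ξ : ℝ, momentumUnitary c (Complex.I • y) ξ =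
    (2 * Real.pi * Complex.I * ξ) • momentumUnitary c x ξ) ↔ _
  rw [map_smul]
  refine eventually_congr ?_
  filter_upwards [Lp.coeFn_smul Complex.I (momentumUnitary c y)] with ξ smul_apply
  have factor_I (w : ℂ) : 2 * Real.pi * Complex.I * ξ * w =
      Complex.I * ((2 * Real.pi * ξ : ℝ) * w) := by
    push_cast
    ring
  rw [smul_apply, Pi.smul_apply, smul_eq_mul, smul_eq_mul, factor_I,
    mul_right_inj' Complex.I_ne_zero]

end Momentum

/-! ### The truncated spectral operator -/

section EssentialRange

variable {φ : ℝ → ℝ}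

theorem mem_essRange_iff {y : ℝ} : y ∈ essRange φ ↔ ∀ ε > 0, 0 < volume {t | |y - φ t| < ε} := by
  simp only [abs_sub_comm y]
  exact Metric.nhds_basis_ball.forall_iff
    fun s t hst hs => hs.trans_le (measure_mono (Set.preimage_mono hst))

theorem essRange_eq_support_map (hφ : Measurable φ) : essRange φ = (volume.map φ).support := by
  ext y
  rw [Metric.nhds_basis_ball.mem_measureSupport, mem_essRange_iff]
  refine forall₂_congr fun ε _ => ?_
  rw [Measure.map_apply hφ measurableSet_ball]
  simp only [abs_sub_comm y]
  rfl

theorem ae_mem_essRange (hφ : Measurable φ) : ∀ᵐ t : ℝ, φ t ∈ essRange φ := by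
  rw [essRange_eq_support_map hφ]
  exact ae_of_ae_map hφ.aemeasurable Measure.support_mem_ae

theorem volume_preimage_mul_left_eq_zero_iff {a : ℝ} (ha : a ≠ 0) (s : Set ℝ) :
    volume ((fun t : ℝ => a * t) ⁻¹' s) = 0 ↔ volume s = 0 := by
  have factor_ne_zero : ENNReal.ofReal |a⁻¹| ≠ 0 := by simpa using ha
  rw [Real.volume_preimage_mul_left ha, mul_eq_zero, or_iff_right factor_ne_zero]

theorem essRange_comp_mul_left {a : ℝ} (ha : a ≠ 0) :
    essRange (fun t => φ (a * t)) = essRange φ := by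
  ext y
  refine forall₂_congr fun U _ => ?_
  rw [pos_iff_ne_zero, pos_iff_ne_zero]
  exact not_congr (volume_preimage_mul_left_eq_zero_iff ha (φ ⁻¹' U))

theorem IsAdmissibleCutoff.ae_abs_le {T₀ T : ℝ} (hφ : IsAdmissibleCutoff T₀ T φ) :
    ∀ᵐ t : ℝ, |φ t| ≤ T := by
  filter_upwards [ae_mem_essRange hφ.1] with t ht
  rw [hφ.2] at ht
  exact ht.2

theorem forall_volume_norm_sub_lt_pos_iff (c : ℝ) (z : ℂ) :
    (∀ ε > 0, 0 < volume {t : ℝ | ‖z - (c + Complex.I * φ t)‖ < ε}) ↔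
      z.re = c ∧ z.im ∈ essRange φ := by
  have sub_eq (t : ℝ) :
      z - (c + Complex.I * φ t) = (z.re - c : ℝ) + (z.im - φ t : ℝ) * Complex.I := by
    apply Complex.ext <;> simp
  by_cases hre : z.re = c
  · simp only [sub_eq, hre, sub_self, Complex.ofReal_zero, zero_add, norm_mul, Complex.norm_I,
      mul_one, Complex.norm_real, Real.norm_eq_abs, true_and, mem_essRange_iff]
  · refine iff_of_false (fun hpos => ?_) (mt And.left hre)
    obtain ⟨t, ht⟩ := nonempty_of_measure_ne_zero
      (hpos |z.re - c| (abs_pos.2 (sub_ne_zero.2 hre))).ne'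
    refine (show ‖z - (c + Complex.I * φ t)‖ < |z.re - c| from ht).not_ge ?_
    simpa using Complex.abs_re_le_norm (z - (c + Complex.I * φ t))

end EssentialRange

section Truncation

variable {φ : ℝ → ℝ} {T : ℝ}

theorem memLp_top_comp_two_pi_mul (hφ : Measurable φ) (hT : ∀ᵐ t : ℝ, |φ t| ≤ T) :
    MemLp (fun ξ : ℝ => (φ (2 * Real.pi * ξ) : ℂ)) ⊤ volume := by
  refine memLp_top_of_bound (C := T) (Measurable.aestronglyMeasurable (by fun_prop)) ?_
  simp only [Complex.norm_real, Real.norm_eq_abs]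
  exact (volume_preimage_mul_left_eq_zero_iff Real.two_pi_pos.ne' _).2 hT

theorem memLp_top_add_I_mul_comp_two_pi_mul (hφ : Measurable φ) (hT : ∀ᵐ t : ℝ, |φ t| ≤ T)
    (c : ℝ) : MemLp (fun ξ : ℝ => (c : ℂ) + Complex.I * φ (2 * Real.pi * ξ)) ⊤ volume :=
  (memLp_top_const (c : ℂ)).add ((memLp_top_comp_two_pi_mul hφ hT).const_mul _)

theorem truncatedShift_eq (c : ℝ) (hφ : Measurable φ) (hT : ∀ᵐ t : ℝ, |φ t| ≤ T) :
    truncatedShift c φ = (momentumUnitary c).conjStarAlgEquiv.symm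
      (mulOp volume fun ξ : ℝ => (c : ℂ) + Complex.I * φ (2 * Real.pi * ξ)) := by
  have hφm : MemLp (fun ξ : ℝ => (φ (2 * Real.pi * ξ) : ℂ)) ⊤ volume :=
    memLp_top_comp_two_pi_mul hφ hT
  have mulOp_eq : mulOp volume (fun ξ : ℝ => (c : ℂ) + Complex.I * φ (2 * Real.pi * ξ)) =
      (c : ℂ) • 1 + Complex.I • mulOp volume fun ξ : ℝ => (φ (2 * Real.pi * ξ) : ℂ) := by
    rw [← smul_one_mul Complex.I, ← mulOp_const, ← mulOp_const, ← mulOp_mul (memLp_top_const _) hφm]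
    exact mulOp_add (memLp_top_const _) (hφm.const_mul _)
  rw [mulOp_eq, truncatedShift, (isMulModel_momentum c).borelCalculus_eq
    (measurable_const_mul _) (g := fun t => (φ t : ℂ)) (by fun_prop) hφm, map_add, map_smul,
    map_smul, map_one]

theorem isStarNormal_truncatedShift (c : ℝ) (hφ : Measurable φ) (hT : ∀ᵐ t : ℝ, |φ t| ≤ T) :
    IsStarNormal (truncatedShift c φ) := by
  rw [truncatedShift_eq c hφ hT]
  have := isStarNormal_mulOp (memLp_top_add_I_mul_comp_two_pi_mul hφ hT c)
  exact IsStarNormal.map _ _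

theorem mem_spectrum_truncatedShift_iff (c : ℝ) (hφ : Measurable φ) (hT : ∀ᵐ t : ℝ, |φ t| ≤ T)
    (z : ℂ) : z ∈ spectrum ℂ (truncatedShift c φ) ↔ z.re = c ∧ z.im ∈ essRange φ := by
  rw [truncatedShift_eq c hφ hT, AlgEquiv.spectrum_eq,
    mem_spectrum_mulOp_iff (memLp_top_add_I_mul_comp_two_pi_mul hφ hT c),
    forall_volume_norm_sub_lt_pos_iff, essRange_comp_mul_left Real.two_pi_pos.ne']

theorem isUnit_truncatedSpectralOperator_iff {c T₀ : ℝ} (hc : c ≠ 1 ∨ 0 < T₀)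
    (hφ : IsAdmissibleCutoff T₀ T φ) :
    IsUnit (truncatedSpectralOperator c φ) ↔
      ∀ z : ℂ, z.re = c → T₀ ≤ |z.im| → |z.im| ≤ T → riemannZeta z ≠ 0 := by
  have mem_spectrum_iff (z : ℂ) :
      z ∈ spectrum ℂ (truncatedShift c φ) ↔ z.re = c ∧ T₀ ≤ |z.im| ∧ |z.im| ≤ T := by
    rw [mem_spectrum_truncatedShift_iff c hφ.1 hφ.ae_abs_le, hφ.2, Set.mem_ofPred_eq]
  have hζ : ContinuousOn riemannZeta (spectrum ℂ (truncatedShift c φ)) := by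
    intro z hz
    obtain ⟨hre, him, -⟩ := (mem_spectrum_iff z).1 hz
    refine (differentiableAt_riemannZeta ?_).continuousAt.continuousWithinAt
    rintro rfl
    rw [Complex.one_re] at hre
    rw [Complex.one_im, abs_zero] at him
    exact hc.elim (fun hne => hne hre.symm) him.not_gt
  rw [truncatedSpectralOperator,
    isUnit_cfc_iff riemannZeta _ hζ (isStarNormal_truncatedShift c hφ.1 hφ.ae_abs_le)]
  simp only [mem_spectrum_iff, and_imp]

variable {c : ℝ} {φ : ℝ → ℝ → ℝ → ℝ}

theorem finite_zeros_of_one_le (hc : 1 ≤ c) : {s : ℂ | s.re = c ∧ riemannZeta s = 0}.Finite := by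
  refine Set.finite_empty.subset ?_
  rintro s ⟨rfl, hζ⟩
  exact riemannZeta_ne_zero_of_one_le_re hc hζ

theorem finite_zeros_of_almostInvertible (hc : c ≠ 1)
    (hφ : ∀ T₀ T : ℝ, 0 ≤ T₀ → T₀ < T → IsAdmissibleCutoff T₀ T (φ T₀ T))
    (hinv : AlmostInvertible c φ) : {s : ℂ | s.re = c ∧ riemannZeta s = 0}.Finite := by
  obtain ⟨T₀, hT₀, hunit⟩ := hinv
  have hcompact : IsCompact (Set.Icc c c ×ℂ Set.Icc (-T₀) T₀) :=
    isCompact_Icc.reProdIm isCompact_Icc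
  refine hcompact.inter_riemannZetaZeros_finite.subset ?_
  rintro s ⟨hre, hζ⟩
  refine ⟨⟨by simp [hre], abs_le.1 ?_⟩, mem_riemannZetaZeros.2 hζ⟩
  by_contra! him
  exact (isUnit_truncatedSpectralOperator_iff (.inl hc) (hφ T₀ _ hT₀ him)).1 (hunit _ him) s hre
    him.le le_rfl hζ

theorem almostInvertible_of_finite_zeros
    (hφ : ∀ T₀ T : ℝ, 0 ≤ T₀ → T₀ < T → IsAdmissibleCutoff T₀ T (φ T₀ T))
    (hfin : {s : ℂ | s.re = c ∧ riemannZeta s = 0}.Finite) : AlmostInvertible c φ := by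
  obtain ⟨M, hM⟩ := (hfin.image fun s : ℂ => |s.im|).bddAbove
  have hpos : 0 < max M 0 + 1 := by positivity
  refine ⟨max M 0 + 1, hpos.le, fun T hT => ?_⟩
  rw [isUnit_truncatedSpectralOperator_iff (.inr hpos) (hφ _ T hpos.le hT)]
  intro z hre him _ hζ
  have him_le : |z.im| ≤ M := hM ⟨z, ⟨hre, hζ⟩, rfl⟩
  linarith [le_max_left M 0]

theorem almostRH_iff :
    AlmostRH ↔ ∀ c ∈ Set.Ioo (1 / 2 : ℝ) 1, {s : ℂ | s.re = c ∧ riemannZeta s = 0}.Finite :=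
  ⟨fun hRH c hc => hRH c hc.1, fun hfin c hc =>
    (lt_or_ge c 1).elim (fun hlt => hfin c ⟨hc, hlt⟩) finite_zeros_of_one_le⟩

end Truncation

end SpectralOp

theorem theorem6p3_general (c : ℝ) (φ : ℝ → ℝ → ℝ → ℝ)
    (hφ : ∀ T₀ T : ℝ, 0 ≤ T₀ → T₀ < T → SpectralOp.IsAdmissibleCutoff T₀ T (φ T₀ T)) :
    SpectralOp.AlmostInvertible c φ ↔ {s : ℂ | s.re = c ∧ riemannZeta s = 0}.Finite := by
  refine ⟨fun hinv => ?_, SpectralOp.almostInvertible_of_finite_zeros hφ⟩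
  rcases lt_or_ge c 1 with hlt | hge
  · exact SpectralOp.finite_zeros_of_almostInvertible hlt.ne hφ hinv
  · exact SpectralOp.finite_zeros_of_one_le hge

theorem theorem6p3 (φ : ℝ → ℝ → ℝ → ℝ → ℝ)
    (hφ : ∀ c ∈ Set.Ioo (1 / 2 : ℝ) 1, ∀ T₀ T : ℝ, 0 ≤ T₀ → T₀ < T →
      SpectralOp.IsAdmissibleCutoff T₀ T (φ c T₀ T)) :
    (∀ c ∈ Set.Ioo (1 / 2 : ℝ) 1, SpectralOp.AlmostInvertible c (φ c)) ↔
      SpectralOp.AlmostRH :=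
  (forall₂_congr fun c hc => theorem6p3_general c (φ c) (hφ c hc)).trans
    SpectralOp.almostRH_iff.symm
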